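/- Let $\mathcal C\subset\mathbb P^3$ be a complex projective algebraic curve (reduced, possibly reducible, all of whose irreducible components have dimension one). The tangent line $\mathcal T_m\mathcal C$ at a nonsingular point $m\in\mathcal C$ is the projective line cut out by the differentials at $m$ of the polynomials vanishing on $\mathcal C$. The tangent curve $\mathbb T\mathcal C\subset\mathbb G(1,3)$ is the Zariski closure, in the set $\mathbb G(1,3)$ of projective lines of $\mathbb P^3$, of the set of the tangent lines to $\mathcal C$ at its nonsingular points; $\mathbb G(1,3)$ is embedded in $\mathbb P^5$ by the Plücker embedding. The rank of $\mathcal C$ is the number of tangent lines to $\mathcal C$ that meet a generic line of $\mathbb P^3$. The degree in $\mathbb P^5$ of the image of $\mathbb T\mathcal C$ is the number of points at which a generic hyperplane of $\mathbb P^5$ meets it. ("Generic" means: for all members of some nonempty Zariski open subset of $\mathbb G(1,3)$, respectively of the dual projective space of $\mathbb P^5$. Isolated points of $\mathbb T\mathcal C$, which come from components of $\mathcal C$ that are lines, thus count for $0$ on both sides.) Then both numbers are well defined and finite, and the rank of $\mathcal C$ equals the degree in $\mathbb P^5$ of the image of $\mathbb T\mathcal C$ under the Plücker embedding. That is, there is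 an integer $d\ge 0$ such that exactly $d$ tangent lines to $\mathcal C$ meet a generic line of $\mathbb P^3$, and a generic hyperplane of $\mathbb P^5$ meets the Plücker image of $\mathbb T\mathcal C$ in exactly $d$ points. -/

import Mathlib

open scoped LinearAlgebra.Projectivization

noncomputable section

namespace SpaceCurve

/-- The complex projective space of dimension `n - 1`, with homogeneous coordinates indexed
by `Fin n`. -/
abbrev Proj (n : ℕ) : Type := ℙ ℂ (Fin n → ℂ)

/-- A subset of projective space is Zariski closed if it is the common zero set of a set of
homogeneous polynomials. (The vanishing of a homogeneous polynomial at a point does not depend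
on the representative of the point.) -/
def IsZariskiClosed {n : ℕ} (Z : Set (Proj n)) : Prop :=
  ∃ S : Set (MvPolynomial (Fin n) ℂ),
    (∀ F ∈ S, ∃ k : ℕ, F.IsHomogeneous k) ∧
      Z = {p | ∀ F ∈ S, MvPolynomial.eval p.rep F = 0}

/-- The Zariski closure of a subset of projective space. -/
def zariskiClosure {n : ℕ} (X : Set (Proj n)) : Set (Proj n) :=
  ⋂₀ {Z | IsZariskiClosed Z ∧ X ⊆ Z}

/-- The affine cone over a subset of projective space, with the origin removed. -/
def cone {n : ℕ} (X : Set (Proj n)) : Set (Fin n → ℂ) :=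
  {v | ∃ h : v ≠ 0, Projectivization.mk ℂ v h ∈ X}

/-- The (homogeneous) ideal of all polynomials which vanish on a subset of projective space. -/
def projIdeal {n : ℕ} (X : Set (Proj n)) : Ideal (MvPolynomial (Fin n) ℂ) :=
  MvPolynomial.vanishingIdeal ℂ (cone X)

/-- A projective algebraic curve, possibly reducible: a nonempty Zariski closed set all of whose
irreducible components have dimension one, i.e. have a homogeneous coordinate ring of
Krull dimension two. -/
structure IsAlgebraicCurve {n : ℕ} (C : Set (Proj n)) : Prop where
  isClosed : IsZariskiClosed C
  nonempty : C.Nonempty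
  dim_eq : ∀ P ∈ (projIdeal C).minimalPrimes,
    ringKrullDim (MvPolynomial (Fin n) ℂ ⧸ P) = 2

/-- The set of projective lines of `ℙ³`: a line is given by a linear subspace of dimension two
of `ℂ⁴`. -/
abbrev Line : Type := {L : Submodule ℂ (Fin 4 → ℂ) // Module.finrank ℂ L = 2}

/-- Two lines meet if they have a common point. -/
def Meets (L M : Line) : Prop :=
  ∃ p : Proj 4, p.submodule ≤ L.1 ∧ p.submodule ≤ M.1

/-- The intersection of the kernels of the differentials at `v` of all polynomials which vanish
on `C`. -/
def tangentSpace (C : Set (Proj 4)) (v : Fin 4 → ℂ) : Submodule ℂ (Fin 4 → ℂ) where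
  carrier := {w | ∀ F ∈ projIdeal C,
    ∑ i, MvPolynomial.eval v (MvPolynomial.pderiv i F) * w i = 0}
  zero_mem' := by
    intro F _
    simp
  add_mem' := by
    intro a b ha hb F hF
    have h1 := ha F hF
    have h2 := hb F hF
    simp only [Pi.add_apply, mul_add, Finset.sum_add_distrib, h1, h2, add_zero]
  smul_mem' := by
    intro c a ha F hF
    have h1 := ha F hF
    have h2 : ∑ i, MvPolynomial.eval v (MvPolynomial.pderiv i F) * (c • a) i
        = c * ∑ i, MvPolynomial.eval v (MvPolynomial.pderiv i F) * a i := by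
      rw [Finset.mul_sum]
      refine Finset.sum_congr rfl fun i _ => ?_
      simp only [Pi.smul_apply, smul_eq_mul]
      ring
    rw [h2, h1, mul_zero]

/-- The set of tangent lines to the curve `C` at its nonsingular points: the point `m` is
nonsingular when the differentials at `m` of the equations of `C` span a space of dimension
two, i.e. when the intersection of their kernels is a line. -/
def tangentLines (C : Set (Proj 4)) : Set Line :=
  {T | ∃ m ∈ C, T.1 = tangentSpace C m.rep}

/-- The Plücker coordinates of a pair of vectors. -/
def wedge (u v : Fin 4 → ℂ) : Fin 6 → ℂ :=
  ![u 0 * v 1 - u 1 * v 0, u 0 * v 2 - u 2 * v 0, u 0 * v 3 - u 3 * v 0,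
    u 1 * v 2 - u 2 * v 1, u 1 * v 3 - u 3 * v 1, u 2 * v 3 - u 3 * v 2]

theorem minor_eq_zero {u v : Fin 4 → ℂ} (h : wedge u v = 0) (i j : Fin 4) :
    u i * v j - u j * v i = 0 := by
  have h0 := congrFun h 0
  have h1 := congrFun h 1
  have h2 := congrFun h 2
  have h3 := congrFun h 3
  have h4 := congrFun h 4
  have h5 := congrFun h 5
  simp [wedge] at h0 h1 h2 h3 h4 h5
  fin_cases i <;> fin_cases j <;> simp <;>
    first
      | linear_combination h0
      | linear_combination h1
      | linear_combination h2
      | linear_combination h3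
      | linear_combination h4
      | linear_combination h5
      | linear_combination -h0
      | linear_combination -h1
      | linear_combination -h2
      | linear_combination -h3
      | linear_combination -h4
      | linear_combination -h5

theorem wedge_ne_zero {u v : Fin 4 → ℂ} (h : LinearIndependent ℂ ![u, v]) :
    wedge u v ≠ 0 := by
  intro hw
  have hu : u ≠ 0 := by simpa using h.ne_zero 0
  obtain ⟨i, hi⟩ := Function.ne_iff.mp hu
  have h2 := (LinearIndependent.pair_iff' hu).mp h (v i / u i)
  apply h2
  funext j
  have h3 := minor_eq_zero hw i j
  have hi' : u i ≠ 0 := hi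
  simp only [Pi.smul_apply, smul_eq_mul]
  field_simp
  linear_combination -h3

/-- A basis of the linear space of a line. -/
def lineBasis (L : Line) : Module.Basis (Fin 2) ℂ L.1 :=
  Module.finBasisOfFinrankEq ℂ L.1 L.2

theorem linearIndependent_lineBasis (L : Line) :
    LinearIndependent ℂ ![(lineBasis L 0 : Fin 4 → ℂ), (lineBasis L 1 : Fin 4 → ℂ)] := by
  have h := (lineBasis L).linearIndependent.map' L.1.subtype L.1.ker_subtype
  have h2 : ![(lineBasis L 0 : Fin 4 → ℂ), (lineBasis L 1 : Fin 4 → ℂ)]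
      = L.1.subtype ∘ lineBasis L := by
    funext i
    fin_cases i <;> rfl
  rw [h2]
  exact h

/-- The Plücker embedding of the set of lines of `ℙ³` in `ℙ⁵`. -/
def plucker (L : Line) : Proj 6 :=
  Projectivization.mk ℂ (wedge (lineBasis L 0) (lineBasis L 1))
    (wedge_ne_zero (linearIndependent_lineBasis L))

/-- The Plücker embedding can be computed from any two vectors which span the line. -/
theorem plucker_eq (L : Line) {u v : Fin 4 → ℂ} (h : LinearIndependent ℂ ![u, v])
    (hu : u ∈ L.1) (hv : v ∈ L.1) :
    plucker L = Projectivization.mk ℂ (wedge u v) (wedge_ne_zero h) := by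
  have key : ∀ w : L.1, ∃ a b : ℂ, (w : Fin 4 → ℂ)
      = a • (lineBasis L 0 : Fin 4 → ℂ) + b • (lineBasis L 1 : Fin 4 → ℂ) := by
    intro w
    refine ⟨(lineBasis L).repr w 0, (lineBasis L).repr w 1, ?_⟩
    have h1 := congrArg (Subtype.val) ((lineBasis L).sum_repr w)
    rw [Fin.sum_univ_two] at h1
    rw [← h1]
    rfl
  obtain ⟨a, b, h1⟩ := key ⟨u, hu⟩
  obtain ⟨c, d, h2⟩ := key ⟨v, hv⟩
  simp only at h1 h2
  have h3 : wedge u v = (a * d - b * c) • wedge (lineBasis L 0) (lineBasis L 1) := by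
    rw [h1, h2]
    funext i
    fin_cases i <;> simp [wedge] <;> ring
  symm
  rw [plucker, Projectivization.mk_eq_mk_iff']
  exact ⟨_, h3.symm⟩

/-- The tangent curve of `C`: the Zariski closure, in the set of lines of `ℙ³` (with the Zariski
topology which comes from the Plücker embedding), of the set of tangent lines to `C`. -/
def tangentCurve (C : Set (Proj 4)) : Set Line :=
  {L | plucker L ∈ zariskiClosure (plucker '' tangentLines C)}

/-- The hyperplane with equation `∑ i, a i * x i = 0`. -/
def hyperplane {n : ℕ} (a : Proj n) : Set (Proj n) :=
  {p | Projectivization.orthogonal a p}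

/-- `X` has exactly `d` points in a generic hyperplane, i.e. in all hyperplanes of some nonempty
Zariski open subset of the dual projective space. For a projective curve `X` this says that `X`
has degree `d`. -/
def HasDegree {n : ℕ} (X : Set (Proj n)) (d : ℕ) : Prop :=
  ∃ Z : Set (Proj n), IsZariskiClosed Z ∧ Z ≠ Set.univ ∧
    ∀ a : Proj n, a ∉ Z → (X ∩ hyperplane a).encard = d

/-- `C` has rank `d`: exactly `d` tangent lines to `C` meet a generic line, i.e. every line of
some nonempty Zariski open subset of the set of lines of `ℙ³`. -/
def HasRank (C : Set (Proj 4)) (d : ℕ) : Prop :=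
  ∃ Z : Set (Proj 6), IsZariskiClosed Z ∧ (∃ L₀ : Line, plucker L₀ ∉ Z) ∧
    ∀ L : Line, plucker L ∉ Z → {T ∈ tangentLines C | Meets T L}.encard = d

end SpaceCurve

end

namespace SpaceCurve

open Polynomial

/-! ### Complex points of finitely generated algebras -/

section PointsOfAlgebra

variable {B : Type*} [CommRing B] [Algebra ℂ B]

/-! A line `T` meets `L` exactly when the Plücker point of `T` lies on the hyperplane whose
coefficient vector is `dualForm` of the Plücker vector of `L` (`meets_iff`). So the rank counts
points on special hyperplanes, those whose coefficients lie on the Klein quadric, while the degree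
allows all hyperplanes. What must be shown is that the open set of hyperplanes with the generic
count meets the quadric. `HasGenericDegree` packages this: one polynomial `Δ` controls the count and
is nonzero at some decomposable vector.

For an irreducible curve in `ℙ⁵`, use a pencil lying inside the quadric: the hyperplanes dual to the
lines through a point `p` in a plane. `exists_isotropic_pencil` finds one, spanned by `a` and `b`,
without base points on the curve. On the chart `b ≠ 0` the function `a / b` is then a finite map to
the affine line; let `e` be the rank of the coordinate ring over `ℂ[X]`. In characteristic zero some
fibre `a = t b` has `e` distinct points (`exists_finset_algHom`), and it is cut out by a special
hyperplane. A Hilbert function comparison shows that no nonzero linear form has colength above `e`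
(`finrank_quotient_le`). The norm of a variable linear form along a separating projection is thus a
polynomial of degree at most `e`, and its coefficient of degree `e` times its discriminant is a `Δ`
which is nonzero at that special hyperplane (`exists_discriminant`).

The tangent lines form a finite union of images of components of the curve under maps given by
minors of gradients. By Chevalley's theorem each image is finite or cofinite in an irreducible curve
(`imagePoints_finite_or`, `tangentPoints_finite_or`). Generic hyperplanes of both kinds avoid any
finite set, so the count passes to unions and from the tangent lines to their closure, with one and
the same `d` for rank and degree. -/

theorem exists_algHom_of_ne_top [Algebra.FiniteType ℂ B] {I : Ideal B} (hI : I ≠ ⊤) :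
    ∃ φ : B →ₐ[ℂ] ℂ, ∀ x ∈ I, φ x = 0 := by
  obtain ⟨m, hm, hIm⟩ := Ideal.exists_le_maximal I hI
  let := Ideal.Quotient.field m
  have : Module.Finite ℂ (B ⧸ m) := finite_of_finite_type_of_isJacobsonRing ℂ (B ⧸ m)
  have hb : Function.Bijective (algebraMap ℂ (B ⧸ m)) :=
    IsAlgClosed.algebraMap_bijective_of_isIntegral
  let e : ℂ ≃ₐ[ℂ] (B ⧸ m) := AlgEquiv.ofBijective (Algebra.ofId ℂ (B ⧸ m)) hb
  refine ⟨(e.symm : (B ⧸ m) →ₐ[ℂ] ℂ).comp (Ideal.Quotient.mkₐ ℂ m), fun x hx => ?_⟩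
  have : Ideal.Quotient.mk m x = 0 := Ideal.Quotient.eq_zero_iff_mem.mpr (hIm hx)
  simp [this]

/-- Distinct algebra homomorphisms are linearly independent, and those that kill `g` factor through
the quotient, hence embed in its dual. -/
theorem card_le_finrank_quotient {g : B} [FiniteDimensional ℂ (B ⧸ Ideal.span {g})]
    (s : Finset (B →ₐ[ℂ] ℂ)) (hs : ∀ φ ∈ s, φ g = 0) :
    s.card ≤ Module.finrank ℂ (B ⧸ Ideal.span {g}) := by
  have hk : ∀ φ : s, ∀ x ∈ Ideal.span {g}, (φ : B →ₐ[ℂ] ℂ) x = 0 := by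
    intro φ x hx
    obtain ⟨c, rfl⟩ := Ideal.mem_span_singleton.mp hx
    rw [map_mul, hs φ φ.2, zero_mul]
  let F : s → ((B ⧸ Ideal.span {g}) →ₐ[ℂ] ℂ) := fun φ => Ideal.Quotient.liftₐ _ φ.1 (hk φ)
  have hF : Function.Injective F := by
    intro φ ψ h
    ext x
    exact DFunLike.congr_fun h (Ideal.Quotient.mk _ x)
  have hl := (linearIndependent_toLinearMap ℂ (B ⧸ Ideal.span {g}) ℂ).comp F hF
  have := hl.fintype_card_le_finrank
  rw [Fintype.card_coe] at this
  refine this.trans (le_of_eq ?_)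
  exact Subspace.dual_finrank_eq

end PointsOfAlgebra

/-! ### Finite covers of the affine line: norms and fibres -/

section FiniteOverLine

variable {B : Type*} [CommRing B] [IsDomain B] [Algebra ℂ B] [Algebra ℂ[X] B]
  [IsScalarTower ℂ ℂ[X] B] [Module.Finite ℂ[X] B] [Module.IsTorsionFree ℂ[X] B]

theorem algHom_algebraMap_polynomial {B : Type*} [CommRing B] [Algebra ℂ B] [Algebra ℂ[X] B]
    [IsScalarTower ℂ ℂ[X] B] (φ : B →ₐ[ℂ] ℂ) (p : ℂ[X]) :
    φ (algebraMap ℂ[X] B p) = p.eval (φ (algebraMap ℂ[X] B X)) := by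
  have : (φ.comp (IsScalarTower.toAlgHom ℂ ℂ[X] B)) = aeval (φ (algebraMap ℂ[X] B X)) := by
    ext
    simp
  have h := DFunLike.congr_fun this p
  simpa [Polynomial.aeval_def, Polynomial.eval₂_eq_eval_map] using h

theorem finrank_quotient_eq_natDegree_norm {g : B} (hg : g ≠ 0) :
    Module.finrank ℂ (B ⧸ Ideal.span {g}) = (Algebra.norm ℂ[X] g).natDegree :=
  finrank_quotient_span_eq_natDegree_norm (Module.Free.chooseBasis ℂ[X] B) hg

theorem finrank_quotient_X_sub_C (t : ℂ) :
    Module.finrank ℂ (B ⧸ Ideal.span {algebraMap ℂ[X] B (X - C t)}) = Module.finrank ℂ[X] B := by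
  have h0 : algebraMap ℂ[X] B (X - C t) ≠ 0 := by
    rw [Ne, FaithfulSMul.algebraMap_eq_zero_iff]
    exact X_sub_C_ne_zero t
  rw [finrank_quotient_eq_natDegree_norm h0, Algebra.norm_algebraMap, natDegree_pow,
    natDegree_X_sub_C, mul_one]

theorem finite_quotient_span {g : B} (hg : g ≠ 0) :
    FiniteDimensional ℂ (B ⧸ Ideal.span {g}) := by
  have hI : Ideal.span {g} ≠ ⊥ := by simpa using hg
  let b := Module.Free.chooseBasis ℂ[X] B
  exact Module.Finite.equiv
    ((Ideal.quotientEquivPiSpan (Ideal.span {g}) b hI).restrictScalars ℂ).symm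

/-- The values of `φ` on a basis form a left null vector of the matrix of multiplication by `g`,
specialised at `t`. It is nonzero because `1` is a combination of the basis. -/
theorem norm_eval_eq_zero {g : B} (φ : B →ₐ[ℂ] ℂ) (h : φ g = 0) :
    (Algebra.norm ℂ[X] g).eval (φ (algebraMap ℂ[X] B X)) = 0 := by
  classical
  let b := Module.Free.chooseBasis ℂ[X] B
  set t := φ (algebraMap ℂ[X] B X)
  rw [Algebra.norm_eq_matrix_det b, ← Polynomial.coe_evalRingHom, RingHom.map_det,
    ← Matrix.exists_vecMul_eq_zero_iff]
  refine ⟨fun i => φ (b i), ?_, ?_⟩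
  · intro h0
    have h1 : φ (∑ i, b.repr 1 i • b i) = 1 := by rw [b.sum_repr]; exact map_one φ
    rw [map_sum] at h1
    refine zero_ne_one (α := ℂ) ?_
    rw [← h1, Finset.sum_eq_zero]
    intro i _
    rw [Algebra.smul_def, map_mul, show φ (b i) = 0 from congrFun h0 i, mul_zero]
  · funext j
    have h1 : φ (∑ i, b.repr (g * b j) i • b i) = 0 := by
      rw [b.sum_repr, map_mul φ, h, zero_mul]
    rw [map_sum] at h1
    simp only [Matrix.vecMul, dotProduct, RingHom.mapMatrix_apply, Matrix.map_apply,
      Algebra.leftMulMatrix_eq_repr_mul, coe_evalRingHom, Pi.zero_apply]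
    rw [← h1]
    refine Finset.sum_congr rfl fun i _ => ?_
    rw [Algebra.smul_def, map_mul φ, algHom_algebraMap_polynomial, mul_comm]

theorem finiteType_of_finite_polynomial {B : Type*} [CommRing B] [Algebra ℂ B] [Algebra ℂ[X] B]
    [IsScalarTower ℂ ℂ[X] B] [Module.Finite ℂ[X] B] : Algebra.FiniteType ℂ B :=
  Algebra.FiniteType.trans (S := ℂ[X]) inferInstance inferInstance

/-- If `X - t` and `g` generated the unit ideal, some multiple `u * g` would be congruent to `1`
modulo `X - t`. Its matrix would specialise to the identity and its norm to `1`, against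
multiplicativity of the norm. -/
theorem exists_algHom_of_norm_eval_eq_zero {g : B} {t : ℂ}
    (h : (Algebra.norm ℂ[X] g).eval t = 0) :
    ∃ φ : B →ₐ[ℂ] ℂ, φ (algebraMap ℂ[X] B X) = t ∧ φ g = 0 := by
  classical
  have := finiteType_of_finite_polynomial (B := B)
  let b := Module.Free.chooseBasis ℂ[X] B
  have hI : Ideal.span {algebraMap ℂ[X] B (X - C t), g} ≠ ⊤ := by
    intro hI
    rw [Ideal.eq_top_iff_one, Ideal.mem_span_pair] at hI
    obtain ⟨v, u, huv⟩ := hI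
    have h1 : u * g = 1 + (X - C t) • (-v) := by
      rw [← huv, Algebra.smul_def]
      ring
    have h2 : (Algebra.norm ℂ[X] (u * g)).eval t = 1 := by
      rw [h1, Algebra.norm_eq_matrix_det b, ← Polynomial.coe_evalRingHom, RingHom.map_det,
        map_add, map_one, map_add, map_one, map_smul]
      have : (evalRingHom t).mapMatrix ((X - C t) • (Algebra.leftMulMatrix b) (-v)) = 0 := by
        ext i j
        simp
      rw [this, add_zero, Matrix.det_one]
    rw [map_mul, eval_mul, h, mul_zero] at h2
    exact zero_ne_one h2
  obtain ⟨φ, hφ⟩ := exists_algHom_of_ne_top hI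
  refine ⟨φ, ?_, hφ _ (Ideal.subset_span (by simp))⟩
  have h1 := hφ _ (Ideal.subset_span (by simp : algebraMap ℂ[X] B (X - C t) ∈ _))
  rw [algHom_algebraMap_polynomial] at h1
  simpa [sub_eq_zero] using h1

end FiniteOverLine

/-! ### Filtrations generated by one element -/

section Growth

variable {B : Type*} [CommRing B] [Algebra ℂ B]

/-- The increasing sequence of subspaces which starts with `W` and in which each term is followed
by its sum with its product by `x`. -/
def growth (x : B) (W : Submodule ℂ B) : ℕ → Submodule ℂ B
  | 0 => W
  | k + 1 => growth x W k ⊔ (growth x W k).map (LinearMap.mulLeft ℂ x)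

theorem growth_mono (x : B) (W : Submodule ℂ B) : Monotone (growth x W) :=
  monotone_nat_of_le_succ fun _ => le_sup_left

theorem growth_fg (x : B) {W : Submodule ℂ B} (hW : W.FG) (k : ℕ) : (growth x W k).FG := by
  induction k with
  | zero => exact hW
  | succ k ih => exact ih.sup (ih.map _)

theorem mul_mem_growth {x g : B} {W : Submodule ℂ B}
    (hg : ∀ w ∈ W, g * w ∈ W ⊔ W.map (LinearMap.mulLeft ℂ x)) (k : ℕ) :
    ∀ f ∈ growth x W k, g * f ∈ growth x W (k + 1) := by
  induction k with
  | zero => exact hg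
  | succ k ih =>
    intro f hf
    obtain ⟨f₁, h₁, f₂, h₂, rfl⟩ := Submodule.mem_sup.mp hf
    obtain ⟨f₃, h₃, rfl⟩ := h₂
    rw [mul_add]
    refine Submodule.add_mem_sup (ih _ h₁) ⟨g * f₃, ih _ h₃, ?_⟩
    simp only [LinearMap.mulLeft_apply]
    ring

/-- Each generator raises the filtration index by at most one, so any product of generators sends
`1` into some term. -/
theorem exists_mem_growth {x : B} {W : Submodule ℂ B} (h1 : (1 : B) ∈ W) {S : Set B}
    (hS : Algebra.adjoin ℂ S = ⊤)
    (hSW : ∀ s ∈ S, ∀ w ∈ W, s * w ∈ W ⊔ W.map (LinearMap.mulLeft ℂ x)) (y : B) :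
    ∃ k, y ∈ growth x W k := by
  have key : ∀ k, ∀ f ∈ growth x W k, ∃ m, y * f ∈ growth x W m := by
    have hy : y ∈ Algebra.adjoin ℂ S := by rw [hS]; trivial
    induction hy using Algebra.adjoin_induction with
    | mem s hs => exact fun k f hf => ⟨k + 1, mul_mem_growth (hSW s hs) k f hf⟩
    | algebraMap c =>
      intro k f hf
      refine ⟨k, ?_⟩
      rw [← Algebra.smul_def]
      exact Submodule.smul_mem _ _ hf
    | add a b _ _ ha hb =>
      intro k f hf
      obtain ⟨m, hm⟩ := ha k f hf
      obtain ⟨n, hn⟩ := hb k f hf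
      refine ⟨max m n, ?_⟩
      rw [add_mul]
      exact add_mem (growth_mono x W (le_max_left m n) hm) (growth_mono x W (le_max_right m n) hn)
    | mul a b _ _ ha hb =>
      intro k f hf
      obtain ⟨m, hm⟩ := hb k f hf
      obtain ⟨n, hn⟩ := ha m _ hm
      exact ⟨n, by rwa [mul_assoc]⟩
  obtain ⟨m, hm⟩ := key 0 1 h1
  exact ⟨m, by rwa [mul_one] at hm⟩

theorem exists_le_growth {x : B} {W : Submodule ℂ B} (h : ∀ y, ∃ k, y ∈ growth x W k)
    {V : Submodule ℂ B} (hV : V.FG) : ∃ k, V ≤ growth x W k := by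
  obtain ⟨s, rfl⟩ := hV
  choose f hf using h
  refine ⟨s.sup f, Submodule.span_le.mpr fun y hy => ?_⟩
  exact growth_mono x W (Finset.le_sup hy) (hf y)

end Growth

/-! ### Linear forms have colength at most the rank -/

section FiniteOverLine

variable {B : Type*} [CommRing B] [IsDomain B] [Algebra ℂ B] [Algebra ℂ[X] B]
  [IsScalarTower ℂ ℂ[X] B] [Module.Finite ℂ[X] B] [Module.IsTorsionFree ℂ[X] B]

/-- In a basis of `B` over `ℂ[X]`, each step raises the degrees of the coordinates by at most one.
This is the upper half of a Hilbert function comparison: linear growth with slope the rank. -/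
theorem exists_finrank_growth_le {W : Submodule ℂ B} (hW : W.FG) :
    ∃ n, ∀ k, Module.finrank ℂ (growth (algebraMap ℂ[X] B X) W k)
      ≤ Module.finrank ℂ[X] B * (n + k) := by
  let b := Module.Free.chooseBasis ℂ[X] B
  let U : ℕ → Submodule ℂ B := fun n =>
    { carrier := {x | ∀ i, (b.repr x i).degree < n}
      zero_mem' := by
        intro i
        simp
      add_mem' := by
        intro x y hx hy i
        rw [map_add, Finsupp.add_apply]
        exact lt_of_le_of_lt (degree_add_le _ _) (max_lt (hx i) (hy i))
      smul_mem' := by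
        intro c x hx i
        rw [← algebraMap_smul ℂ[X] c x, map_smul, Finsupp.smul_apply]
        rw [algebraMap_smul]
        exact lt_of_le_of_lt (degree_smul_le _ _) (hx i) }
  have hfin : ∀ n, FiniteDimensional ℂ (U n) ∧
      Module.finrank ℂ (U n) ≤ Module.finrank ℂ[X] B * n := by
    intro n
    let f : U n →ₗ[ℂ] (Module.Free.ChooseBasisIndex ℂ[X] B → Fin n → ℂ) :=
      { toFun := fun x i j => (b.repr x.1 i).coeff j
        map_add' := by
          intro x y
          ext i j
          simp
        map_smul' := by
          intro c x
          ext i j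
          have : b.repr (c • x.1) i = c • b.repr x.1 i := by
            rw [← algebraMap_smul ℂ[X] c x.1, map_smul, Finsupp.smul_apply, algebraMap_smul]
          simp [this] }
    have hf : Function.Injective f := by
      intro x y hxy
      apply Subtype.ext
      apply b.repr.injective
      ext i j
      by_cases hj : j < n
      · exact congrFun (congrFun hxy i) ⟨j, hj⟩
      · rw [coeff_eq_zero_of_degree_lt, coeff_eq_zero_of_degree_lt]
        · exact (y.2 i).trans_le (by exact_mod_cast not_lt.mp hj)
        · exact (x.2 i).trans_le (by exact_mod_cast not_lt.mp hj)
    have hfd : FiniteDimensional ℂ (U n) := Module.Finite.of_injective f hf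
    refine ⟨hfd, ?_⟩
    have := LinearMap.finrank_le_finrank_of_injective hf
    simp only [Module.finrank_pi_fintype, Module.finrank_self, Finset.sum_const,
      Finset.card_univ, smul_eq_mul, mul_one, Fintype.card_fin] at this
    rwa [Module.finrank_eq_card_chooseBasisIndex ℂ[X] B]
  have hUm : Monotone U := by
    intro m n hmn x hx i
    exact (hx i).trans_le (by exact_mod_cast hmn)
  have hX : ∀ n, ∀ x ∈ U n, algebraMap ℂ[X] B X * x ∈ U (n + 1) := by
    intro n x hx i
    rw [← Algebra.smul_def, map_smul, Finsupp.smul_apply, smul_eq_mul, mul_comm, degree_mul_X]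
    have := hx i
    push_cast
    exact WithBot.add_lt_add_right (by simp) this
  obtain ⟨n, hn⟩ : ∃ n, W ≤ U n := by
    obtain ⟨s, rfl⟩ := hW
    refine ⟨s.sup fun x => Finset.univ.sup fun i => (b.repr x i).natDegree + 1,
      Submodule.span_le.mpr fun x hx => ?_⟩
    refine hUm (Finset.le_sup hx) fun i => ?_
    refine (degree_le_natDegree).trans_lt ?_
    have : (b.repr x i).natDegree + 1 ≤ Finset.univ.sup fun i => (b.repr x i).natDegree + 1 :=
      Finset.le_sup (f := fun i => (b.repr x i).natDegree + 1) (Finset.mem_univ i)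
    exact_mod_cast this
  have hle : ∀ k, growth (algebraMap ℂ[X] B X) W k ≤ U (n + k) := by
    intro k
    induction k with
    | zero => exact hn
    | succ k ih =>
      refine sup_le (ih.trans (hUm (by omega))) ?_
      rintro _ ⟨x, hx, rfl⟩
      exact hX _ x (ih hx)
  refine ⟨n, fun k => ?_⟩
  have : FiniteDimensional ℂ (growth (algebraMap ℂ[X] B X) W k) :=
    Module.Finite.iff_fg.mpr (growth_fg _ hW k)
  have := (hfin (n + k)).1
  exact (Submodule.finrank_mono (hle k)).trans (hfin _).2

/-- Multiplication by `g` is injective and shifts the filtration by one. A complement `V` of the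
ideal of `g` is disjoint from its image, so the dimension grows by at least `dim V` at each step;
the growth rate is at most the rank. -/
theorem finrank_quotient_le {W : Submodule ℂ B} (hW : W.FG) (h1 : (1 : B) ∈ W) {S : Set B}
    (hS : Algebra.adjoin ℂ S = ⊤)
    (hSW : ∀ s ∈ S, ∀ w ∈ W, s * w ∈ W ⊔ W.map (LinearMap.mulLeft ℂ (algebraMap ℂ[X] B X)))
    {g : B} (hg0 : g ≠ 0)
    (hg : ∀ w ∈ W, g * w ∈ W ⊔ W.map (LinearMap.mulLeft ℂ (algebraMap ℂ[X] B X))) :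
    Module.finrank ℂ (B ⧸ Ideal.span {g}) ≤ Module.finrank ℂ[X] B := by
  have := finite_quotient_span hg0
  set τ := algebraMap ℂ[X] B X
  obtain ⟨V, hV⟩ := Submodule.exists_isCompl ((Ideal.span {g}).restrictScalars ℂ)
  let eV : (B ⧸ Ideal.span {g}) ≃ₗ[ℂ] V :=
    (Submodule.Quotient.restrictScalarsEquiv ℂ (Ideal.span {g})).symm.trans
      (Submodule.quotientEquivOfIsCompl _ V hV)
  have hVfin : FiniteDimensional ℂ V := Module.Finite.equiv eV
  have hVr : Module.finrank ℂ V = Module.finrank ℂ (B ⧸ Ideal.span {g}) :=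
    eV.finrank_eq.symm
  obtain ⟨j, hj⟩ := exists_le_growth (exists_mem_growth h1 hS hSW) (Module.Finite.iff_fg.mp hVfin)
  obtain ⟨n, hn⟩ := exists_finrank_growth_le hW
  have hfd : ∀ k, FiniteDimensional ℂ (growth τ W k) := fun k =>
    Module.Finite.iff_fg.mpr (growth_fg _ hW k)
  have hlow : ∀ k, Module.finrank ℂ V * k ≤ Module.finrank ℂ (growth τ W (j + k)) := by
    intro k
    induction k with
    | zero => simp
    | succ k ih =>
      let G := (growth τ W (j + k)).map (LinearMap.mulLeft ℂ g)
      have hGf : FiniteDimensional ℂ G := inferInstance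
      have hG : Module.finrank ℂ G = Module.finrank ℂ (growth τ W (j + k)) :=
        (Submodule.equivMapOfInjective (LinearMap.mulLeft ℂ g)
          (mul_right_injective₀ hg0) (growth τ W (j + k))).finrank_eq.symm
      have hdis : V ⊓ G = ⊥ := by
        rw [eq_bot_iff]
        rintro x ⟨hxV, y, -, rfl⟩
        have : (LinearMap.mulLeft ℂ g) y ∈ (Ideal.span {g}).restrictScalars ℂ :=
          Ideal.mem_span_singleton.mpr ⟨y, rfl⟩
        exact hV.disjoint.le_bot ⟨this, hxV⟩
      have hle : V ⊔ G ≤ growth τ W (j + (k + 1)) := by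
        refine sup_le (hj.trans (growth_mono _ _ (by omega))) ?_
        rintro _ ⟨y, hy, rfl⟩
        exact mul_mem_growth hg _ y hy
      have h2 := Submodule.finrank_sup_add_finrank_inf_eq V G
      rw [hdis, finrank_bot, add_zero, hG] at h2
      have h3 := Submodule.finrank_mono hle
      rw [mul_add, mul_one]
      omega
  rw [← hVr]
  by_contra! hlt
  set e := Module.finrank ℂ[X] B
  -- The index `k = e * (n + j) + 1` is large enough that `(e + 1) * k > e * (n + j + k)`.
  have h4 := (hlow (e * (n + j) + 1)).trans (hn (j + (e * (n + j) + 1)))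
  have h5 : (e + 1) * (e * (n + j) + 1) ≤ Module.finrank ℂ V * (e * (n + j) + 1) :=
    Nat.mul_le_mul_right _ hlt
  nlinarith

end FiniteOverLine

/-! ### A fibre with as many points as the rank -/

section FiniteOverLine

/-- The resultant of `χ` and its derivative is a nonzero polynomial in `t`. Where it does not
vanish, its Bézout identity specialises to coprimality of the specialised polynomial and its
derivative. -/
theorem exists_eval_ne_zero_imp_nodup_roots {χ : ℂ[X][X]} (hm : χ.Monic)
    (hs : (χ.map (algebraMap ℂ[X] (FractionRing ℂ[X]))).Separable) :
    ∃ t, (χ.map (evalRingHom t)).roots.Nodup := by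
  by_cases hd : χ.natDegree = 0
  · rw [eq_one_of_monic_natDegree_zero hm hd]
    exact ⟨0, by simp⟩
  have hinj := IsFractionRing.injective ℂ[X] (FractionRing ℂ[X])
  have hr : resultant χ (derivative χ) ≠ 0 := by
    intro h0
    have h1 := resultant_map_map (f := χ) (g := derivative χ) (m := χ.natDegree)
      (n := (derivative χ).natDegree) (algebraMap ℂ[X] (FractionRing ℂ[X]))
    rw [h0, map_zero, ← natDegree_map_eq_of_injective hinj χ,
      ← natDegree_map_eq_of_injective hinj (derivative χ), resultant_eq_zero_iff,
      ← derivative_map] at h1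
    exact h1.2 hs
  obtain ⟨t, ht⟩ : ∃ t, (resultant χ (derivative χ)).eval t ≠ 0 := by
    by_contra! h
    exact hr (Polynomial.funext fun t => by rw [h t, eval_zero])
  obtain ⟨p, q, -, -, hpq⟩ := exists_mul_add_mul_eq_C_resultant χ (derivative χ) le_rfl le_rfl
    (Or.inl hd)
  refine ⟨t, nodup_roots ?_⟩
  set r := (resultant χ (derivative χ)).eval t with hrdef
  have h2 := congrArg (Polynomial.map (evalRingHom t)) hpq
  rw [Polynomial.map_add, Polynomial.map_mul, Polynomial.map_mul, map_C, coe_evalRingHom,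
    ← hrdef] at h2
  refine ⟨C r⁻¹ * p.map (evalRingHom t), C r⁻¹ * q.map (evalRingHom t), ?_⟩
  rw [derivative_map, mul_assoc, mul_assoc, ← mul_add, mul_comm (p.map _), mul_comm (q.map _), h2,
    ← C_mul, inv_mul_cancel₀ ht, C_1]

variable {B : Type*} [CommRing B] [IsDomain B] [Algebra ℂ B] [Algebra ℂ[X] B]
  [IsScalarTower ℂ ℂ[X] B] [Module.Finite ℂ[X] B] [Module.IsTorsionFree ℂ[X] B]

variable (B) in
theorem exists_natDegree_minpoly_eq_finrank :
    ∃ w : B, (minpoly ℂ[X] w).natDegree = Module.finrank ℂ[X] B ∧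
      ((minpoly ℂ[X] w).map (algebraMap ℂ[X] (FractionRing ℂ[X]))).Separable := by
  let k := FractionRing ℂ[X]
  let L := FractionRing B
  have hi : Algebra.IsIntegral ℂ[X] B := inferInstance
  let : Algebra k L := FractionRing.liftAlgebra ℂ[X] L
  have : IsScalarTower ℂ[X] k L := inferInstance
  have hfr : Module.finrank k L = Module.finrank ℂ[X] B := IsFractionRing.finrank_eq ℂ[X] k B L
  have : FiniteDimensional k L := by
    refine Module.finite_of_finrank_pos ?_
    rw [hfr]
    exact Module.finrank_pos
  have : CharZero k := inferInstance
  obtain ⟨w₀, hw₀⟩ := Field.exists_primitive_element k L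
  obtain ⟨b₁, b₂, hb₂, rfl⟩ := IsFractionRing.div_surjective (A := B) w₀
  -- A multiple `b₂ * c` of the denominator lies in `ℂ[X]`. Replacing `b₁ / b₂` by `b₁ * c`
  -- therefore only multiplies the primitive element by a nonzero element of the base field.
  obtain ⟨r, hr0, c, hc⟩ := (Algebra.IsAlgebraic.isAlgebraic (R := ℂ[X]) b₂).exists_nonzero_dvd hb₂
  refine ⟨b₁ * c, ?_⟩
  have hmap := minpoly.isIntegrallyClosed_eq_field_fractions k L (hi.isIntegral (b₁ * c))
  have hw : IntermediateField.adjoin k {algebraMap B L (b₁ * c)} = ⊤ := by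
    rw [eq_top_iff, ← hw₀, IntermediateField.adjoin_simple_le_iff]
    have h1 : algebraMap B L b₁ / algebraMap B L b₂
        = algebraMap B L (b₁ * c) * (algebraMap k L (algebraMap ℂ[X] k r))⁻¹ := by
      have hb : algebraMap B L b₂ ≠ 0 := by
        rw [Ne, FaithfulSMul.algebraMap_eq_zero_iff]
        exact nonZeroDivisors.ne_zero hb₂
      have hr' : algebraMap k L (algebraMap ℂ[X] k r) = algebraMap B L b₂ * algebraMap B L c := by
        rw [← map_mul, ← hc, ← IsScalarTower.algebraMap_apply, ← IsScalarTower.algebraMap_apply]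
      have hr0' : algebraMap k L (algebraMap ℂ[X] k r) ≠ 0 := by
        rw [Ne, FaithfulSMul.algebraMap_eq_zero_iff, FaithfulSMul.algebraMap_eq_zero_iff]
        exact hr0
      rw [hr'] at hr0' ⊢
      have hc0 : algebraMap B L c ≠ 0 := right_ne_zero_of_mul hr0'
      rw [map_mul, ← div_eq_mul_inv, mul_div_mul_right _ _ hc0]
    rw [h1]
    exact mul_mem (IntermediateField.mem_adjoin_simple_self k _)
      (inv_mem (IntermediateField.algebraMap_mem _ _))
  constructor
  · rw [← hfr, ← (Field.primitive_element_iff_minpoly_natDegree_eq k _).mp hw, hmap,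
      natDegree_map_eq_of_injective (IsFractionRing.injective ℂ[X] k)]
  · rw [← hmap]
    exact (minpoly.irreducible (Algebra.IsIntegral.isIntegral _)).separable

variable (B) in
/-- Almost all fibres have as many points as the rank. -/
theorem exists_finset_algHom :
    ∃ t : ℂ, ∃ s : Finset (B →ₐ[ℂ] ℂ), Module.finrank ℂ[X] B ≤ s.card ∧
      ∀ φ ∈ s, φ (algebraMap ℂ[X] B X) = t := by
  classical
  obtain ⟨w, hdeg, hsep⟩ := exists_natDegree_minpoly_eq_finrank B
  have hw : IsIntegral ℂ[X] w := Algebra.IsIntegral.isIntegral w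
  set χ := minpoly ℂ[X] w
  have hχ : χ.Monic := minpoly.monic hw
  obtain ⟨t, ht⟩ := exists_eval_ne_zero_imp_nodup_roots hχ hsep
  -- The minimal polynomial divides the characteristic polynomial of multiplication by `w`, and both
  -- are monic of degree the rank.
  have hch : (Algebra.lmul ℂ[X] B w).charpoly = χ := by
    refine eq_of_monic_of_dvd_of_natDegree_le hχ (Algebra.lmul ℂ[X] B w).charpoly_monic ?_ ?_
    · refine minpoly.isIntegrallyClosed_dvd hw ?_
      have h := LinearMap.aeval_self_charpoly (Algebra.lmul ℂ[X] B w)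
      rw [aeval_algHom_apply] at h
      simpa using DFunLike.congr_fun h 1
    · rw [(Algebra.lmul ℂ[X] B w).charpoly_natDegree, hdeg]
  -- The norm of `ρ - w` at `t` is the characteristic polynomial specialised at `t` and evaluated at
  -- `ρ`. So each root is the value of `w` at a point of the fibre.
  have hroot : ∀ ρ : ℂ, (χ.map (evalRingHom t)).IsRoot ρ →
      ∃ φ : B →ₐ[ℂ] ℂ, φ (algebraMap ℂ[X] B X) = t ∧ φ w = ρ := by
    intro ρ hρ
    have h1 : (Algebra.norm ℂ[X] (algebraMap ℂ[X] B (C ρ) - w)).eval t = 0 := by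
      rw [Algebra.norm_apply, map_sub, AlgHom.commutes, ← LinearMap.eval_charpoly, hch]
      change evalRingHom t (eval (C ρ) χ) = 0
      rw [← eval₂_at_apply]
      simpa [IsRoot, eval_map] using hρ
    obtain ⟨φ, hφ, hφw⟩ := exists_algHom_of_norm_eval_eq_zero h1
    refine ⟨φ, hφ, ?_⟩
    rw [map_sub, algHom_algebraMap_polynomial, eval_C, sub_eq_zero] at hφw
    exact hφw.symm
  have := finiteType_of_finite_polynomial (B := B)
  have : Nonempty (B →ₐ[ℂ] ℂ) :=
    ⟨(exists_algHom_of_ne_top (B := B) (I := ⊥) bot_ne_top).choose⟩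
  choose! φ hφ hφw using hroot
  have hmem : ∀ ρ ∈ (χ.map (evalRingHom t)).roots.toFinset, (χ.map (evalRingHom t)).IsRoot ρ := by
    intro ρ hρ
    exact isRoot_of_mem_roots (Multiset.mem_toFinset.mp hρ)
  refine ⟨t, (χ.map (evalRingHom t)).roots.toFinset.image φ, ?_, ?_⟩
  · rw [Finset.card_image_of_injOn, Multiset.toFinset_card_of_nodup ht,
      ← (IsAlgClosed.splits _).natDegree_eq_card_roots, hχ.natDegree_map, hdeg]
    intro a ha b hb hab
    rw [← hφw a (hmem a ha), ← hφw b (hmem b hb)]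
    exact congrArg (fun f : B →ₐ[ℂ] ℂ => f w) hab
  · intro ψ hψ
    obtain ⟨ρ, hρ, rfl⟩ := Finset.mem_image.mp hψ
    exact hφ ρ (hmem ρ hρ)

end FiniteOverLine

/-- The formal degrees `e` and `e - 1` are fixed so that the resultant of a family commutes with
specialisation even where the leading coefficient vanishes. For `e = 0` the truncated subtraction
agrees with `natDegree` of the zero derivative. -/
theorem resultant_derivative_ne_zero_iff {p : ℂ[X]} {e : ℕ} (h : p.natDegree = e) (h0 : p ≠ 0) :
    resultant p (derivative p) e (e - 1) ≠ 0 ↔ p.roots.Nodup := by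
  rw [nodup_roots_iff_of_splits h0 (IsAlgClosed.splits p)]
  have h1 : (derivative p).natDegree = e - 1 := by
    rw [natDegree_derivative, h]
  rw [← h1, ← h, Ne, resultant_eq_zero_iff, not_and, not_not]
  exact ⟨fun H => H (Or.inl h0), fun H _ => H⟩

/-! ### Counting zeros of linear forms on an affine curve -/

section Chart

variable {B : Type*} [CommRing B] [IsDomain B] [Algebra ℂ B] {n : ℕ}

/-- The linear combination of the coordinate functions `y` with coefficients `c`. -/
def linComb (y : Fin n → B) (c : Fin n → ℂ) : B := ∑ i, c i • y i

/-- The coordinate functions are integral of degree one over the linear form `c`, in the sense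
that they multiply some finite dimensional space which contains `1` into its sum with its product
by the linear form. -/
def IsFiniteProjection (y : Fin n → B) (c : Fin n → ℂ) : Prop :=
  ∃ W : Submodule ℂ B, W.FG ∧ (1 : B) ∈ W ∧
    ∀ i, ∀ w ∈ W, y i * w ∈ W ⊔ W.map (LinearMap.mulLeft ℂ (linComb y c))

theorem finite_algHom [FiniteDimensional ℂ B] : Finite (B →ₐ[ℂ] ℂ) := by
  have := (linearIndependent_toLinearMap ℂ B ℂ).finite
  exact this

/-- An algebraic element of a domain over `ℂ` is a constant. Then `W` would be stable under
multiplication by the generators, hence all of `B`, and a finite dimensional algebra has finitely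
many points. -/
theorem transcendental_linComb [Infinite (B →ₐ[ℂ] ℂ)] {y : Fin n → B}
    (hy : Algebra.adjoin ℂ (Set.range y) = ⊤) {c : Fin n → ℂ} (hc : IsFiniteProjection y c) :
    Function.Injective (aeval (R := ℂ) (linComb y c)) := by
  rw [← transcendental_iff_injective]
  intro halg
  obtain ⟨W, hW, h1, hyW⟩ := hc
  have hint : IsIntegral ℂ (linComb y c) := halg.isIntegral
  obtain ⟨t, ht⟩ : ∃ t, algebraMap ℂ B t = linComb y c :=
    minpoly.mem_range_of_degree_eq_one ℂ _
      (IsAlgClosed.degree_eq_one_of_irreducible ℂ (minpoly.irreducible hint))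
  have hgr : ∀ k, growth (linComb y c) W k ≤ W := by
    intro k
    induction k with
    | zero => exact le_rfl
    | succ k ih =>
      refine sup_le ih ?_
      rintro _ ⟨x, hx, rfl⟩
      rw [LinearMap.mulLeft_apply, ← ht, ← Algebra.smul_def]
      exact W.smul_mem _ (ih hx)
  have htop : W = ⊤ := by
    rw [eq_top_iff]
    intro b _
    obtain ⟨k, hk⟩ := exists_mem_growth h1 hy (by rintro _ ⟨i, rfl⟩; exact hyW i) b
    exact hgr k hk
  have : FiniteDimensional ℂ B := ⟨htop ▸ hW⟩
  have := finite_algHom (B := B)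
  exact _root_.not_finite (B →ₐ[ℂ] ℂ)

theorem module_finite_of_isFiniteProjection [Algebra ℂ[X] B] [IsScalarTower ℂ ℂ[X] B]
    {y : Fin n → B} (hy : Algebra.adjoin ℂ (Set.range y) = ⊤) {c : Fin n → ℂ}
    (hc : IsFiniteProjection y c) (hX : algebraMap ℂ[X] B X = linComb y c) :
    Module.Finite ℂ[X] B := by
  obtain ⟨W, ⟨s, hs⟩, h1, hyW⟩ := hc
  refine ⟨s, ?_⟩
  have hW : W ≤ (Submodule.span ℂ[X] (s : Set B)).restrictScalars ℂ := by
    rw [← hs]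
    exact Submodule.span_le.mpr Submodule.subset_span
  have hgr : ∀ k, growth (linComb y c) W k
      ≤ (Submodule.span ℂ[X] (s : Set B)).restrictScalars ℂ := by
    intro k
    induction k with
    | zero => exact hW
    | succ k ih =>
      refine sup_le ih ?_
      rintro _ ⟨x, hx, rfl⟩
      rw [LinearMap.mulLeft_apply, ← hX, ← Algebra.smul_def]
      exact Submodule.smul_mem (Submodule.span ℂ[X] (s : Set B)) X (ih hx)
  rw [eq_top_iff]
  intro b _
  obtain ⟨k, hk⟩ := exists_mem_growth h1 hy (by rintro _ ⟨i, rfl⟩; exact hyW i) b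
  exact hgr k hk

theorem linComb_mul_mem {y : Fin n → B} {W N : Submodule ℂ B} (h : ∀ i, ∀ w ∈ W, y i * w ∈ N)
    (a : Fin n → ℂ) : ∀ w ∈ W, linComb y a * w ∈ N := by
  intro w hw
  rw [linComb, Finset.sum_mul]
  refine Submodule.sum_mem _ fun i _ => ?_
  rw [smul_mul_assoc]
  exact N.smul_mem _ (h i w hw)

/-- A linear form which defines a finite projection has a fibre with at least as many points as
the colength of any linear form. -/
theorem exists_fibre [Infinite (B →ₐ[ℂ] ℂ)] {y : Fin n → B}
    (hy : Algebra.adjoin ℂ (Set.range y) = ⊤) {a : Fin n → ℂ} (ha : IsFiniteProjection y a) :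
    ∃ e : ℕ, ∃ t : ℂ, ∃ s : Finset (B →ₐ[ℂ] ℂ), e ≤ s.card ∧
      (∀ φ ∈ s, φ (linComb y a) = t) ∧
      Module.finrank ℂ (B ⧸ Ideal.span {linComb y a - algebraMap ℂ B t}) = e ∧
      linComb y a - algebraMap ℂ B t ≠ 0 ∧
      ∀ a', linComb y a' ≠ 0 → FiniteDimensional ℂ (B ⧸ Ideal.span {linComb y a'}) ∧
        Module.finrank ℂ (B ⧸ Ideal.span {linComb y a'}) ≤ e := by
  have hinj := transcendental_linComb hy ha
  let : Algebra ℂ[X] B := (aeval (R := ℂ) (linComb y a)).toAlgebra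
  have hX : algebraMap ℂ[X] B X = linComb y a := aeval_X (R := ℂ) (linComb y a)
  have hinj' : Function.Injective (algebraMap ℂ[X] B) := hinj
  have : IsScalarTower ℂ ℂ[X] B :=
    IsScalarTower.of_algebraMap_eq fun t => (aeval_C (linComb y a) t).symm
  have : Module.Finite ℂ[X] B := module_finite_of_isFiniteProjection hy ha hX
  have : FaithfulSMul ℂ[X] B := (faithfulSMul_iff_algebraMap_injective _ _).mpr hinj'
  have : Module.IsTorsionFree ℂ[X] B := inferInstance
  obtain ⟨t, s, hs, hst⟩ := exists_finset_algHom B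
  have ht : algebraMap ℂ[X] B (X - C t) = linComb y a - algebraMap ℂ B t := by
    rw [map_sub, hX, IsScalarTower.algebraMap_apply ℂ ℂ[X] B]
    rfl
  refine ⟨Module.finrank ℂ[X] B, t, s, hs, ?_, ?_, ?_, ?_⟩
  · rwa [hX] at hst
  · rw [← ht, finrank_quotient_X_sub_C]
  · rw [← ht, Ne, FaithfulSMul.algebraMap_eq_zero_iff]
    exact X_sub_C_ne_zero t
  · intro a' ha'
    refine ⟨finite_quotient_span ha', ?_⟩
    obtain ⟨W, hW, h1, hyW⟩ := ha
    rw [← hX] at hyW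
    exact finrank_quotient_le hW h1 hy (by rintro _ ⟨i, rfl⟩; exact hyW i) ha'
      (linComb_mul_mem hyW a')

/-- For a finite projection `c`, the norms of the linear forms are the values of one polynomial
with coefficients which are polynomial functions. -/
theorem exists_norm_polynomial [Infinite (B →ₐ[ℂ] ℂ)] {y : Fin n → B}
    (hy : Algebra.adjoin ℂ (Set.range y) = ⊤) {c : Fin n → ℂ} (hc : IsFiniteProjection y c) :
    ∃ P : (MvPolynomial (Fin n) ℂ)[X], ∀ a : Fin n → ℂ,
      (linComb y a = 0 → P.map (MvPolynomial.eval a) = 0) ∧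
      (linComb y a ≠ 0 → P.map (MvPolynomial.eval a) ≠ 0 ∧ (P.map (MvPolynomial.eval a)).natDegree
        = Module.finrank ℂ (B ⧸ Ideal.span {linComb y a})) ∧
      ∀ t, (P.map (MvPolynomial.eval a)).IsRoot t ↔
        ∃ φ : B →ₐ[ℂ] ℂ, φ (linComb y c) = t ∧ φ (linComb y a) = 0 := by
  classical
  have hinj := transcendental_linComb hy hc
  let : Algebra ℂ[X] B := (aeval (R := ℂ) (linComb y c)).toAlgebra
  have hX : algebraMap ℂ[X] B X = linComb y c := aeval_X (R := ℂ) (linComb y c)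
  have hinj' : Function.Injective (algebraMap ℂ[X] B) := hinj
  have : IsScalarTower ℂ ℂ[X] B :=
    IsScalarTower.of_algebraMap_eq fun t => (aeval_C (linComb y c) t).symm
  have : Module.Finite ℂ[X] B := module_finite_of_isFiniteProjection hy hc hX
  have : FaithfulSMul ℂ[X] B := (faithfulSMul_iff_algebraMap_injective _ _).mpr hinj'
  have : Module.IsTorsionFree ℂ[X] B := inferInstance
  let b := Module.Free.chooseBasis ℂ[X] B
  let M := fun i => (Algebra.leftMulMatrix b (y i)).map (Polynomial.map (MvPolynomial.C (σ := Fin n)))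
  -- Multiplication by a linear form has a matrix that is linear in the coefficients; `D` is this
  -- matrix with indeterminate coefficients.
  let D := ∑ i, (C (MvPolynomial.X i) : (MvPolynomial (Fin n) ℂ)[X]) • M i
  have key : ∀ a : Fin n → ℂ, D.det.map (MvPolynomial.eval a) = Algebra.norm ℂ[X] (linComb y a) := by
    intro a
    rw [Algebra.norm_eq_matrix_det b, ← coe_mapRingHom, RingHom.map_det, map_sum, linComb, map_sum]
    congr 1
    refine Finset.sum_congr rfl fun i _ => ?_
    have h2 : Algebra.leftMulMatrix b (a i • y i)
        = (C (a i) : ℂ[X]) • Algebra.leftMulMatrix b (y i) := by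
      rw [← algebraMap_smul ℂ[X] (a i) (y i), map_smul]
      rfl
    rw [h2]
    ext1 j k
    simp only [M, RingHom.mapMatrix_apply, Matrix.map_apply, Matrix.smul_apply, smul_eq_mul,
      coe_mapRingHom]
    rw [Polynomial.map_mul, map_C, MvPolynomial.eval_X, Polynomial.map_map]
    congr 1
    have : (MvPolynomial.eval a).comp (MvPolynomial.C (σ := Fin n)) = RingHom.id ℂ := by
      ext x
      simp
    rw [this, Polynomial.map_id]
  refine ⟨D.det, fun a => ?_⟩
  rw [key a]
  refine ⟨fun h => by rw [h, Algebra.norm_zero], fun h => ⟨?_, ?_⟩, fun t => ⟨fun h => ?_, ?_⟩⟩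
  · rwa [Algebra.norm_ne_zero_iff]
  · rw [finrank_quotient_eq_natDegree_norm h]
  · obtain ⟨φ, hφ, hφ'⟩ := exists_algHom_of_norm_eval_eq_zero h
    exact ⟨φ, hX ▸ hφ, hφ'⟩
  · rintro ⟨φ, hφ, hφ'⟩
    have := norm_eval_eq_zero φ hφ'
    rwa [hX, hφ] at this

/-- The number of zeros of a linear form lies between the number of distinct roots of its norm along
`c` and its colength, which is at most `e`. Where the norm has degree `e` and simple roots, both
bounds equal `e`. The projection `c` is chosen to separate a fibre of `a` with `e` points, so that
this occurs for `a - t • b`. -/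
theorem exists_discriminant [Infinite (B →ₐ[ℂ] ℂ)] {y : Fin n → B}
    (hy : Algebra.adjoin ℂ (Set.range y) = ⊤) {a b : Fin n → ℂ} (ha : IsFiniteProjection y a)
    (hb : linComb y b = 1)
    (hsep : ∀ s : Finset (B →ₐ[ℂ] ℂ), ∃ c, IsFiniteProjection y c ∧
      Set.InjOn (fun φ : B →ₐ[ℂ] ℂ => φ (linComb y c)) s) :
    ∃ e : ℕ, ∃ Δ : MvPolynomial (Fin n) ℂ, ∃ t : ℂ, MvPolynomial.eval (a - t • b) Δ ≠ 0 ∧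
      ∀ a', MvPolynomial.eval a' Δ ≠ 0 →
        {φ : B →ₐ[ℂ] ℂ | φ (linComb y a') = 0}.encard = e := by
  classical
  obtain ⟨e, t, s, hes, hst, hrank, hne, hle⟩ := exists_fibre hy ha
  obtain ⟨c, hc, hinj⟩ := hsep s
  obtain ⟨P, hP⟩ := exists_norm_polynomial hy hc
  have hdeg : ∀ a', (P.map (MvPolynomial.eval a')).natDegree ≤ e := by
    intro a'
    by_cases h : linComb y a' = 0
    · rw [(hP a').1 h]
      simp
    · rw [((hP a').2.1 h).2]
      exact (hle a' h).2
  have hlin : linComb y (a - t • b) = linComb y a - algebraMap ℂ B t := by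
    rw [Algebra.algebraMap_eq_smul_one, ← hb]
    simp [linComb, sub_smul, mul_smul, Finset.smul_sum]
  have hΔ : ∀ a', MvPolynomial.eval a' (P.coeff e * resultant P (derivative P) e (e - 1))
      = (P.map (MvPolynomial.eval a')).coeff e * resultant (P.map (MvPolynomial.eval a'))
        (derivative (P.map (MvPolynomial.eval a'))) e (e - 1) := by
    intro a'
    rw [map_mul, coeff_map, derivative_map, resultant_map_map]
  refine ⟨e, P.coeff e * resultant P (derivative P) e (e - 1), t, ?_, ?_⟩
  · rw [hΔ]
    have h1 : linComb y (a - t • b) ≠ 0 := by rwa [hlin]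
    obtain ⟨hQ0, hQd⟩ := (hP (a - t • b)).2.1 h1
    rw [hlin, hrank] at hQd
    set Q := P.map (MvPolynomial.eval (a - t • b))
    refine mul_ne_zero ?_ ?_
    · rw [← hQd, coeff_natDegree]
      exact leadingCoeff_ne_zero.mpr hQ0
    -- The points of `s` have distinct values under `c`, all of them roots of `Q`, so the degree `e`
    -- is exhausted by distinct roots.
    · rw [resultant_derivative_ne_zero_iff hQd hQ0, ← Multiset.toFinset_card_eq_card_iff_nodup]
      refine le_antisymm (Multiset.toFinset_card_le _) ?_
      have h2 : (s.image fun φ : B →ₐ[ℂ] ℂ => φ (linComb y c)) ⊆ Q.roots.toFinset := by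
        intro x hx
        obtain ⟨φ, hφ, rfl⟩ := Finset.mem_image.mp hx
        rw [Multiset.mem_toFinset, mem_roots hQ0]
        refine ((hP _).2.2 _).mpr ⟨φ, rfl, ?_⟩
        rw [hlin, map_sub, hst φ hφ, AlgHom.commutes]
        simp
      calc Q.roots.card ≤ Q.natDegree := card_roots' Q
        _ = e := hQd
        _ ≤ s.card := hes
        _ = _ := (Finset.card_image_of_injOn hinj).symm
        _ ≤ _ := Finset.card_le_card h2
  · intro a' ha'
    rw [hΔ] at ha'
    set Q := P.map (MvPolynomial.eval a')
    have hcoeff : Q.coeff e ≠ 0 := left_ne_zero_of_mul ha'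
    have hQ0 : Q ≠ 0 := by
      rintro h
      rw [h, coeff_zero] at hcoeff
      exact hcoeff rfl
    have hQd : Q.natDegree = e := le_antisymm (hdeg a') (le_natDegree_of_ne_zero hcoeff)
    have h1 : linComb y a' ≠ 0 := fun h => hQ0 ((hP a').1 h)
    have hnd := (resultant_derivative_ne_zero_iff hQd hQ0).mp (right_ne_zero_of_mul ha')
    have := (hle a' h1).1
    refine le_antisymm ?_ ?_
    · rw [← not_lt]
      intro hlt
      have h2 : ((e + 1 : ℕ) : ℕ∞) ≤ {φ : B →ₐ[ℂ] ℂ | φ (linComb y a') = 0}.encard := by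
        push_cast
        exact Order.add_one_le_of_lt hlt
      obtain ⟨u, hu, hcard⟩ := Set.exists_subset_encard_eq h2
      have hfin : u.Finite := Set.finite_of_encard_eq_coe hcard
      have h3 := card_le_finrank_quotient (g := linComb y a') hfin.toFinset
        (fun φ hφ => hu (hfin.mem_toFinset.mp hφ))
      have h4 := (hle a' h1).2
      rw [hfin.encard_eq_coe_toFinset_card] at hcard
      have h5 : hfin.toFinset.card = e + 1 := by exact_mod_cast hcard
      omega
    · have hroot : ∀ ρ ∈ Q.roots.toFinset, ∃ φ : B →ₐ[ℂ] ℂ, φ (linComb y c) = ρ ∧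
          φ (linComb y a') = 0 := by
        intro ρ hρ
        exact ((hP a').2.2 ρ).mp (isRoot_of_mem_roots (Multiset.mem_toFinset.mp hρ))
      have hsub : (Q.roots.toFinset : Set ℂ) ⊆ (fun φ : B →ₐ[ℂ] ℂ => φ (linComb y c)) ''
          {φ : B →ₐ[ℂ] ℂ | φ (linComb y a') = 0} := by
        intro ρ hρ
        obtain ⟨φ, h2, h3⟩ := hroot ρ hρ
        exact ⟨φ, h3, h2⟩
      refine le_trans ?_ ((Set.encard_le_encard hsub).trans (Set.encard_image_le _ _))
      rw [Set.encard_coe_eq_coe_finsetCard, Multiset.toFinset_card_of_nodup hnd,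
        ← (IsAlgClosed.splits Q).natDegree_eq_card_roots, hQd]

end Chart

end SpaceCurve

namespace SpaceCurve

open MvPolynomial
open scoped LinearAlgebra.Projectivization

/-! ### Homogeneous ideals and finiteness of proper sections of curves -/

section HomogeneousIdeals

variable {n : ℕ}

theorem eval_smul_of_isHomogeneous {F : MvPolynomial (Fin n) ℂ} {k : ℕ} (hF : F.IsHomogeneous k)
    (c : ℂ) (v : Fin n → ℂ) : eval (c • v) F = c ^ k * eval v F := by
  rw [eval_eq', eval_eq', Finset.mul_sum]
  refine Finset.sum_congr rfl fun d hd => ?_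
  have hk : ∑ i, d i = k := by
    have := hF (mem_support_iff.mp hd)
    rw [← this, Finsupp.weight_apply, Finsupp.sum_fintype] <;> simp
  simp only [Pi.smul_apply, smul_eq_mul, mul_pow]
  rw [Finset.prod_mul_distrib, Finset.prod_pow_eq_pow_sum, hk]
  ring

theorem eval_smul_eq_sum (F : MvPolynomial (Fin n) ℂ) (c : ℂ) (v : Fin n → ℂ) :
    eval (c • v) F = ∑ k ∈ Finset.range (F.totalDegree + 1),
      c ^ k * eval v (homogeneousComponent k F) := by
  conv_lhs => rw [← sum_homogeneousComponent F]
  rw [map_sum]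
  exact Finset.sum_congr rfl fun k _ =>
    eval_smul_of_isHomogeneous (homogeneousComponent_isHomogeneous k F) c v

theorem eval_homogeneousComponent_eq_zero {F : MvPolynomial (Fin n) ℂ} {v : Fin n → ℂ}
    (h : ∀ c : ℂ, c ≠ 0 → eval (c • v) F = 0) (k : ℕ) : eval v (homogeneousComponent k F) = 0 := by
  by_cases hk : F.totalDegree < k
  · rw [homogeneousComponent_eq_zero _ _ hk, map_zero]
  let p : Polynomial ℂ := ∑ k ∈ Finset.range (F.totalDegree + 1),
    Polynomial.C (eval v (homogeneousComponent k F)) * Polynomial.X ^ k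
  have hp : p = 0 := by
    refine Polynomial.eq_zero_of_infinite_isRoot p ?_
    refine Set.Infinite.mono (s := {0}ᶜ) ?_ (Set.finite_singleton 0).infinite_compl
    intro c hc
    have := h c hc
    rw [eval_smul_eq_sum] at this
    simp only [Set.mem_ofPred_eq, Polynomial.IsRoot, p, Polynomial.eval_finsetSum]
    rw [← this]
    refine Finset.sum_congr rfl fun k _ => ?_
    rw [Polynomial.eval_mul, Polynomial.eval_C, Polynomial.eval_pow, Polynomial.eval_X, mul_comm]
  have h2 := congrArg (fun q => Polynomial.coeff q k) hp
  simp only [p, Polynomial.finsetSum_coeff, Polynomial.coeff_C_mul, Polynomial.coeff_X_pow,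
    Polynomial.coeff_zero] at h2
  simpa [Nat.lt_succ_iff, not_lt.mp hk] using h2

/-- An ideal which contains the homogeneous components of its elements. -/
def IsHomIdeal (J : Ideal (MvPolynomial (Fin n) ℂ)) : Prop :=
  ∀ F ∈ J, ∀ k, homogeneousComponent k F ∈ J

/-- The affine set of zeros of an ideal. -/
def zeros (J : Ideal (MvPolynomial (Fin n) ℂ)) : Set (Fin n → ℂ) := {v | ∀ F ∈ J, eval v F = 0}

/-- The set of points of projective space at which an ideal vanishes. -/
def projZeros (J : Ideal (MvPolynomial (Fin n) ℂ)) : Set (Proj n) := {p | p.rep ∈ zeros J}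

theorem smul_mem_zeros {J : Ideal (MvPolynomial (Fin n) ℂ)} (hJ : IsHomIdeal J)
    {v : Fin n → ℂ} (hv : v ∈ zeros J) (c : ℂ) : c • v ∈ zeros J := by
  intro F hF
  rw [eval_smul_eq_sum]
  exact Finset.sum_eq_zero fun k _ => by rw [hv _ (hJ F hF k), mul_zero]

theorem rep_mk_mem_zeros {J : Ideal (MvPolynomial (Fin n) ℂ)} (hJ : IsHomIdeal J)
    {v : Fin n → ℂ} (hv : v ≠ 0) : Projectivization.mk ℂ v hv ∈ projZeros J ↔ v ∈ zeros J := by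
  obtain ⟨a, ha⟩ := Projectivization.exists_smul_eq_mk_rep ℂ v hv
  constructor
  · intro h
    have h2 := smul_mem_zeros hJ h ((a⁻¹ : ℂˣ) : ℂ)
    rw [← ha] at h2
    rw [← Units.smul_def, inv_smul_smul] at h2
    exact h2
  · intro h
    change (Projectivization.mk ℂ v hv).rep ∈ zeros J
    rw [← ha]
    exact smul_mem_zeros hJ h (a : ℂ)

/-- Any three elements of the quotient by the ideal are algebraically dependent. -/
def HasDimLETwo (J : Ideal (MvPolynomial (Fin n) ℂ)) : Prop :=
  ∀ f : Fin 3 → MvPolynomial (Fin n) ℂ, ∃ r : MvPolynomial (Fin 3) ℂ, r ≠ 0 ∧ aeval f r ∈ J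

/-- Since `J` is prime and misses `G`, all powers of `G` can be divided out of an algebraic relation
among `G`, `X i`, `X j`. Its constant term in `G` is then a nonzero relation between the two
coordinates wherever `G` vanishes. -/
theorem exists_relation {J : Ideal (MvPolynomial (Fin n) ℂ)} [J.IsPrime] (hd : HasDimLETwo J)
    {G : MvPolynomial (Fin n) ℂ} (hG : G ∉ J) (i j : Fin n) :
    ∃ r : MvPolynomial (Fin 2) ℂ, r ≠ 0 ∧
      ∀ v ∈ zeros J, eval v G = 0 → eval ![v i, v j] r = 0 := by
  obtain ⟨R, hR0, hR⟩ := hd ![G, X i, X j]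
  set q := finSuccEquiv ℂ 2 R
  have hq0 : q ≠ 0 := by simpa [q] using hR0
  obtain ⟨q', hq', hq'X⟩ := Polynomial.exists_eq_pow_rootMultiplicity_mul_and_not_dvd q hq0 0
  have key : ∀ p : Polynomial (MvPolynomial (Fin 2) ℂ),
      aeval ![G, X i, X j] ((finSuccEquiv ℂ 2).symm p)
        = p.eval₂ (aeval ![(X i : MvPolynomial (Fin n) ℂ), X j] :
            MvPolynomial (Fin 2) ℂ →ₐ[ℂ] _).toRingHom G := by
    intro p
    induction p using Polynomial.induction_on' with
    | add p q hp hq => simp only [map_add, hp, hq, Polynomial.eval₂_add]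
    | monomial k a =>
      rw [← Polynomial.C_mul_X_pow_eq_monomial]
      simp only [map_mul, map_pow, Polynomial.eval₂_mul, Polynomial.eval₂_pow, Polynomial.eval₂_X,
        Polynomial.eval₂_C]
      have h1 : (finSuccEquiv ℂ 2).symm (Polynomial.X) = X 0 := by
        rw [AlgEquiv.symm_apply_eq, finSuccEquiv_X_zero]
      have h2 : (finSuccEquiv ℂ 2).symm (Polynomial.C a) = rename Fin.succ a := by
        rw [AlgEquiv.symm_apply_eq]
        induction a using MvPolynomial.induction_on with
        | C c =>
          rw [rename_C, ← AlgEquiv.symm_apply_eq]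
          exact (RingHom.congr_fun (finSuccEquiv_comp_C_eq_C (R := ℂ) 2) c)
        | add p q hp hq => rw [map_add, map_add, map_add, hp, hq]
        | mul_X p l hp =>
          rw [map_mul, map_mul, map_mul, rename_X, finSuccEquiv_X_succ, hp]
      rw [h1, h2, aeval_X, aeval_rename]
      congr 2
  have hR' : G ^ (q.rootMultiplicity 0) *
      q'.eval₂ (aeval ![(X i : MvPolynomial (Fin n) ℂ), X j] :
            MvPolynomial (Fin 2) ℂ →ₐ[ℂ] _).toRingHom G ∈ J := by
    have h1 : R = (finSuccEquiv ℂ 2).symm q := by simp [q]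
    rw [h1, key, hq'] at hR
    simpa [Polynomial.eval₂_mul] using hR
  have hq'J := (Ideal.IsPrime.mem_or_mem ‹_› hR').resolve_left
    fun h => hG (Ideal.IsPrime.mem_of_pow_mem ‹_› _ h)
  refine ⟨q'.coeff 0, ?_, ?_⟩
  · intro h
    apply hq'X
    rw [Polynomial.C_0, sub_zero, Polynomial.X_dvd_iff]
    exact h
  · intro v hv hGv
    have h1 := hv _ hq'J
    rw [← coe_aeval_eq_eval, RingHom.coe_coe] at h1
    rw [← AlgHom.coe_toRingHom, Polynomial.hom_eval₂] at h1
    have h2 : (aeval v : MvPolynomial (Fin n) ℂ →ₐ[ℂ] ℂ).toRingHom G = 0 := by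
      simpa [aeval_eq_eval] using hGv
    change Polynomial.eval₂ _ ((aeval v : MvPolynomial (Fin n) ℂ →ₐ[ℂ] ℂ).toRingHom G) q' = 0 at h1
    rw [h2, Polynomial.eval₂_at_zero] at h1
    rw [← h1]
    change _ = aeval v (aeval _ _)
    rw [← AlgHom.comp_apply, comp_aeval, ← coe_aeval_eq_eval, RingHom.coe_coe]
    congr 2
    ext l
    fin_cases l <;> simp

theorem exists_finite_ratios {r : MvPolynomial (Fin 2) ℂ} (hr : r ≠ 0) :
    ∃ T : Set ℂ, T.Finite ∧ ∀ t : ℂ, (∀ c : ℂ, eval (c • ![1, t]) r = 0) → t ∈ T := by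
  obtain ⟨k, hk⟩ : ∃ k, homogeneousComponent k r ≠ 0 := by
    by_contra! h
    apply hr
    rw [← sum_homogeneousComponent r]
    exact Finset.sum_eq_zero fun k _ => h k
  set ρ := homogeneousComponent k r
  have hρ : ρ.IsHomogeneous k := homogeneousComponent_isHomogeneous k r
  let p : Polynomial ℂ := aeval ![1, Polynomial.X] ρ
  have hp : ∀ t, p.eval t = eval ![1, t] ρ := by
    intro t
    rw [← Polynomial.coe_aeval_eq_eval, ← AlgHom.comp_apply, comp_aeval, ← coe_aeval_eq_eval,
      RingHom.coe_coe]
    congr 2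
    ext l
    fin_cases l <;> simp
  have hp0 : p ≠ 0 := by
    intro h0
    -- Dehomogenisation sees only the points with nonzero first coordinate; the factor `X 0` takes
    -- care of the others.
    have h1 : ρ * X 0 = 0 := by
      refine MvPolynomial.funext fun v => ?_
      rw [map_mul, eval_X, map_zero]
      by_cases hv : v 0 = 0
      · rw [hv, mul_zero]
      · have h2 : v = v 0 • ![1, v 1 / v 0] := by
          ext l
          fin_cases l <;> simp [mul_div_cancel₀, hv]
        rw [h2, eval_smul_of_isHomogeneous hρ, ← hp, h0]
        simp
    rcases mul_eq_zero.mp h1 with h | h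
    · exact hk h
    · exact X_ne_zero 0 h
  refine ⟨{t | p.IsRoot t}, Polynomial.finite_setOfPred_isRoot hp0, fun t ht => ?_⟩
  change p.eval t = 0
  rw [hp]
  exact eval_homogeneousComponent_eq_zero (fun c _ => ht c) k

/-- On the chart where coordinate `i` is nonzero, every ratio of coordinates takes finitely many
values. As `G` need not be homogeneous, its vanishing is required along the whole line of
representatives. -/
theorem finite_projZeros_inter {J : Ideal (MvPolynomial (Fin n) ℂ)} [J.IsPrime]
    (hJ : IsHomIdeal J) (hd : HasDimLETwo J) {G : MvPolynomial (Fin n) ℂ} (hG : G ∉ J) :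
    {p ∈ projZeros J | ∀ c : ℂ, eval (c • p.rep) G = 0}.Finite := by
  have hT : ∀ i j : Fin n, ∃ T : Set ℂ, T.Finite ∧ ∀ v ∈ zeros J, v i ≠ 0 →
      (∀ c : ℂ, eval (c • v) G = 0) → (v i)⁻¹ * v j ∈ T := by
    intro i j
    obtain ⟨r, hr0, hr⟩ := exists_relation hd hG i j
    obtain ⟨T, hT, hT'⟩ := exists_finite_ratios hr0
    refine ⟨T, hT, fun v hv hvi hc => hT' _ fun c => ?_⟩
    have h1 := hr _ (smul_mem_zeros hJ hv (c * (v i)⁻¹)) (hc _)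
    rw [← h1]
    congr 2
    ext l
    fin_cases l <;> simp [hvi, mul_assoc]
  choose T hT hT' using hT
  have hcover : {p ∈ projZeros J | ∀ c : ℂ, eval (c • p.rep) G = 0} ⊆
      ⋃ i : Fin n, {p | p ∈ projZeros J ∧ (∀ c : ℂ, eval (c • p.rep) G = 0) ∧ p.rep i ≠ 0} := by
    rintro p ⟨h1, h2⟩
    obtain ⟨i, hi⟩ := Function.ne_iff.mp p.rep_nonzero
    exact Set.mem_iUnion.mpr ⟨i, h1, h2, hi⟩
  refine Set.Finite.subset (Set.finite_iUnion fun i => ?_) hcover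
  refine Set.Finite.of_injOn (f := fun p : Proj n => (p.rep i)⁻¹ • p.rep)
    (t := Set.pi Set.univ (T i)) ?_ ?_ (Set.Finite.pi fun j => hT i j)
  · rintro p ⟨h1, h2, h3⟩ j -
    exact hT' i j _ h1 h3 h2
  · rintro p ⟨h1, h2, h3⟩ q ⟨h4, h5, h6⟩ h
    rw [← p.mk_rep, ← q.mk_rep, Projectivization.mk_eq_mk_iff']
    refine ⟨p.rep i * (q.rep i)⁻¹, ?_⟩
    rw [mul_smul, show (q.rep i)⁻¹ • q.rep = (p.rep i)⁻¹ • p.rep from h.symm, smul_smul,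
      mul_inv_cancel₀ h3, one_smul]

end HomogeneousIdeals

/-! ### Base-point-free projections and affine charts -/

section LinearProjection

variable {n : ℕ}

/-- The linear form with given coefficients. -/
noncomputable def linForm (c : Fin n → ℂ) : MvPolynomial (Fin n) ℂ := ∑ i, C (c i) * X i

theorem eval_linForm (c v : Fin n → ℂ) : eval v (linForm c) = c ⬝ᵥ v := by
  simp [linForm, dotProduct]

theorem isHomogeneous_linForm (c : Fin n → ℂ) : (linForm c).IsHomogeneous 1 :=
  IsHomogeneous.sum _ _ _ fun i _ => isHomogeneous_C_mul_X (c i) i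

theorem aeval_linForm {B : Type*} [CommRing B] [Algebra ℂ B] (y : Fin n → B) (c : Fin n → ℂ) :
    aeval y (linForm c) = linComb y c := by
  simp [linForm, linComb, Algebra.smul_def]

theorem homogeneousComponent_mul_of_isHomogeneous {F G : MvPolynomial (Fin n) ℂ} {k : ℕ}
    (hF : F.IsHomogeneous k) (m : ℕ) :
    homogeneousComponent (k + m) (F * G) = F * homogeneousComponent m G := by
  conv_lhs => rw [← sum_homogeneousComponent G, Finset.mul_sum, map_sum]
  have h : ∀ i, homogeneousComponent (k + m) (F * homogeneousComponent i G)
      = if i = m then F * homogeneousComponent i G else 0 := by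
    intro i
    rw [homogeneousComponent_of_mem (hF.mul (homogeneousComponent_isHomogeneous i G))]
    simp [eq_comm]
  simp only [h]
  rw [Finset.sum_ite_eq']
  split_ifs with hm
  · rfl
  · rw [homogeneousComponent_eq_zero, mul_zero]
    simpa using hm

theorem exists_pow_span_X_le {I : Ideal (MvPolynomial (Fin n) ℂ)} (h : ∀ v ∈ zeros I, v = 0) :
    ∃ N, Ideal.span (Set.range X) ^ N ≤ I := by
  refine Ideal.exists_pow_le_of_le_radical_of_fg ?_ (IsNoetherian.noetherian _)
  rw [Ideal.span_le]
  rintro _ ⟨i, rfl⟩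
  rw [← vanishingIdeal_zeroLocus_eq_radical (K := ℂ)]
  intro v hv
  have hv0 : v = 0 := h v fun F hF => by
    rw [← coe_aeval_eq_eval]
    exact hv F hF
  simp [hv0]

/-- By the Nullstellensatz, `J` and the two linear forms together generate an ideal containing a
power of the irrelevant ideal. Taking homogeneous components makes the two coefficients forms of
degree `N`. -/
theorem exists_forms_of_no_common_zeros {J : Ideal (MvPolynomial (Fin n) ℂ)} (hJ : IsHomIdeal J)
    {b c : Fin n → ℂ} (h : ∀ v ∈ zeros J, b ⬝ᵥ v = 0 → c ⬝ᵥ v = 0 → v = 0) :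
    ∃ N, ∀ F : MvPolynomial (Fin n) ℂ, F.IsHomogeneous (N + 1) →
      ∃ q₁ q₂ : MvPolynomial (Fin n) ℂ, q₁.IsHomogeneous N ∧ q₂.IsHomogeneous N ∧
        F - (linForm b * q₁ + linForm c * q₂) ∈ J := by
  obtain ⟨N, hN⟩ := exists_pow_span_X_le (I := J ⊔ Ideal.span {linForm b, linForm c}) (by
    intro v hv
    refine h v (fun F hF => hv F (Ideal.mem_sup_left hF)) ?_ ?_ <;> rw [← eval_linForm] <;>
    exact hv _ (Ideal.mem_sup_right (Ideal.subset_span (by simp))))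
  refine ⟨N, fun F hF => ?_⟩
  have hF' : F ∈ Ideal.span (Set.range X) ^ (N + 1) := by
    rw [Ideal.span_pow_eq_map_homogeneousSubmodule]
    refine ⟨map C F, hF.map C, ?_⟩
    change aeval X (map C F) = F
    rw [aeval_def, eval₂_map]
    exact eval₂_eta F
  obtain ⟨j, hj, g, hg, rfl⟩ := Submodule.mem_sup.mp (hN (Ideal.pow_le_pow_right (Nat.le_succ N) hF'))
  obtain ⟨p₁, p₂, rfl⟩ := Ideal.mem_span_pair.mp hg
  refine ⟨homogeneousComponent N p₁, homogeneousComponent N p₂,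
    homogeneousComponent_isHomogeneous N p₁, homogeneousComponent_isHomogeneous N p₂, ?_⟩
  have h1 := homogeneousComponent_eq_self hF
  rw [map_add, map_add, mul_comm p₁, mul_comm p₂, add_comm N 1,
    homogeneousComponent_mul_of_isHomogeneous (isHomogeneous_linForm b),
    homogeneousComponent_mul_of_isHomogeneous (isHomogeneous_linForm c)] at h1
  rw [mul_comm p₁, mul_comm p₂, ← h1, add_sub_cancel_right]
  exact hJ j hj _

/-- `W` consists of the dehomogenised forms of degree `N`. As `b` becomes `1` on the chart, writing
a form of degree `N + 1` as `b * q₁ + c * q₂` modulo `J` places it in `W + c * W`. -/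
theorem isFiniteProjection_of_no_common_zeros {B : Type*} [CommRing B] [Algebra ℂ B] [IsDomain B]
    {J : Ideal (MvPolynomial (Fin n) ℂ)} (hJ : IsHomIdeal J) {y : Fin n → B}
    (hy : ∀ F ∈ J, aeval y F = 0) {b c : Fin n → ℂ} (hb : linComb y b = 1)
    (h : ∀ v ∈ zeros J, b ⬝ᵥ v = 0 → c ⬝ᵥ v = 0 → v = 0) : IsFiniteProjection y c := by
  obtain ⟨N, hN⟩ := exists_forms_of_no_common_zeros hJ h
  refine ⟨(homogeneousSubmodule (Fin n) ℂ N).map (aeval y).toLinearMap,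
    (homogeneousSubmodule_fg _ _ N).map _, ⟨linForm b ^ N, ?_, ?_⟩, ?_⟩
  · have := (isHomogeneous_linForm b).pow N
    rwa [one_mul] at this
  · change aeval y (linForm b ^ N) = 1
    rw [map_pow, aeval_linForm, hb, one_pow]
  · rintro i _ ⟨ω, hω, rfl⟩
    have h1 : (X i * ω).IsHomogeneous (N + 1) := by
      rw [add_comm]
      exact (isHomogeneous_X ℂ i).mul hω
    obtain ⟨q₁, q₂, hq₁, hq₂, hq⟩ := hN _ h1
    have h2 := hy _ hq
    rw [map_sub, sub_eq_zero, map_mul, aeval_X, map_add, map_mul, map_mul, aeval_linForm,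
      aeval_linForm, hb, one_mul] at h2
    change y i * aeval y ω ∈ _
    rw [h2]
    exact Submodule.add_mem_sup ⟨q₁, hq₁, rfl⟩ ⟨aeval y q₂, ⟨q₂, hq₂, rfl⟩, rfl⟩

/-- The affine chart of a projective variety where a linear form does not vanish. -/
theorem exists_chart {J : Ideal (MvPolynomial (Fin n) ℂ)} [J.IsPrime] (hJ : IsHomIdeal J)
    {b : Fin n → ℂ} (hb : linForm b ∉ J) :
    ∃ (B : Type) (_ : CommRing B) (_ : IsDomain B) (_ : Algebra ℂ B) (y : Fin n → B),
      Algebra.adjoin ℂ (Set.range y) = ⊤ ∧ linComb y b = 1 ∧ (∀ F ∈ J, aeval y F = 0) ∧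
      ∀ v ∈ zeros J, b ⬝ᵥ v = 1 → ∃ φ : B →ₐ[ℂ] ℂ, ∀ i, φ (y i) = v i := by
  let A := MvPolynomial (Fin n) ℂ ⧸ J
  let K := FractionRing A
  let π : MvPolynomial (Fin n) ℂ →ₐ[ℂ] K := (IsScalarTower.toAlgHom ℂ A K).comp
    (Ideal.Quotient.mkₐ ℂ J)
  have hπ : ∀ F, π F = 0 ↔ F ∈ J := by
    intro F
    change algebraMap A K (Ideal.Quotient.mk J F) = 0 ↔ _
    rw [FaithfulSMul.algebraMap_eq_zero_iff, Ideal.Quotient.eq_zero_iff_mem]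
  set m := π (linForm b)
  have hm : m ≠ 0 := fun h => hb ((hπ _).mp h)
  -- `θ` is dehomogenisation by the form `b`; its range is the coordinate ring of the chart.
  let θ : MvPolynomial (Fin n) ℂ →ₐ[ℂ] K := aeval fun i => π (X i) * m⁻¹
  have hθ : ∀ k, ∀ F : MvPolynomial (Fin n) ℂ, F.IsHomogeneous k → θ F = π F * m⁻¹ ^ k := by
    intro k F hF
    have hπF : π F = aeval (fun i => π (X i)) F := by
      conv_lhs => rw [← aeval_X_left_apply F, ← AlgHom.comp_apply, comp_aeval]
    rw [hπF]
    simp only [θ, aeval_def, eval₂_eq']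
    rw [Finset.sum_mul]
    refine Finset.sum_congr rfl fun d hd => ?_
    have hk : ∑ i, d i = k := by
      have := hF (mem_support_iff.mp hd)
      rw [← this, Finsupp.weight_apply, Finsupp.sum_fintype] <;> simp
    simp only [mul_pow]
    rw [Finset.prod_mul_distrib, Finset.prod_pow_eq_pow_sum, hk, mul_assoc]
  have hθJ : ∀ F ∈ J, θ F = 0 := by
    intro F hF
    rw [← sum_homogeneousComponent F, map_sum]
    refine Finset.sum_eq_zero fun k _ => ?_
    rw [hθ k _ (homogeneousComponent_isHomogeneous k F), (hπ _).mpr (hJ F hF k), zero_mul]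
  have hcomp : ∀ y : Fin n → θ.range, (∀ i, (y i : K) = θ (X i)) → ∀ F,
      ((aeval y F : θ.range) : K) = θ F := by
    intro y hy F
    have : θ.range.val.comp (aeval y) = θ := by
      ext i
      simp [hy]
    exact DFunLike.congr_fun this F
  let y : Fin n → θ.range := fun i => ⟨θ (X i), X i, rfl⟩
  refine ⟨θ.range, inferInstance, inferInstance, inferInstance, y, ?_, ?_, ?_, ?_⟩
  · rw [eq_top_iff]
    rintro ⟨_, F, rfl⟩ -
    have h1 : (⟨θ F, F, rfl⟩ : θ.range) = aeval y F := Subtype.ext (hcomp y (fun _ => rfl) F).symm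
    rw [Algebra.adjoin_range_eq_range_aeval]
    exact ⟨F, h1.symm⟩
  · apply Subtype.ext
    rw [← aeval_linForm, hcomp y (fun _ => rfl), hθ 1 _ (isHomogeneous_linForm b), pow_one]
    exact mul_inv_cancel₀ hm
  · intro F hF
    apply Subtype.ext
    rw [hcomp y (fun _ => rfl), hθJ F hF]
    rfl
  · intro v hv hbv
    have hker : ∀ F, θ F = 0 → eval v F = 0 := by
      intro F hF
      set d := F.totalDegree
      -- This is the homogenisation of `F` by powers of `b`, which has the same value as `F` at a
      -- vector where `b` equals `1`.
      have h1 : ∑ k ∈ Finset.range (d + 1), homogeneousComponent k F * linForm b ^ (d - k) ∈ J := by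
        rw [← hπ, map_sum]
        have h2 : ∀ k ∈ Finset.range (d + 1), π (homogeneousComponent k F * linForm b ^ (d - k))
            = θ (homogeneousComponent k F) * m ^ d := by
          intro k hk
          rw [hθ k _ (homogeneousComponent_isHomogeneous k F), map_mul, map_pow, mul_assoc]
          congr 1
          rw [inv_pow, eq_inv_mul_iff_mul_eq₀ (pow_ne_zero k hm), ← pow_add]
          congr 1
          have := Finset.mem_range.mp hk
          omega
        rw [Finset.sum_congr rfl h2, ← Finset.sum_mul, ← map_sum, sum_homogeneousComponent, hF,
          zero_mul]
      have h3 := hv _ h1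
      simp only [map_sum, map_mul, map_pow, eval_linForm, hbv, one_pow, mul_one] at h3
      rw [← sum_homogeneousComponent F, map_sum]
      exact h3
    let χ : (MvPolynomial (Fin n) ℂ ⧸ RingHom.ker θ) →ₐ[ℂ] ℂ :=
      Ideal.Quotient.liftₐ (RingHom.ker θ) (aeval v) (by
        intro F hF
        rw [aeval_eq_eval]
        exact hker F hF)
    refine ⟨χ.comp (Ideal.quotientKerEquivRange θ).symm.toAlgHom, fun i => ?_⟩
    have h4 : (Ideal.quotientKerEquivRange θ).symm (y i) = Ideal.Quotient.mk _ (X i) := by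
      rw [AlgEquiv.symm_apply_eq]
      rfl
    change χ ((Ideal.quotientKerEquivRange θ).symm (y i)) = v i
    rw [h4]
    simp [χ]

end LinearProjection

/-! ### Generic counts that remain valid on special hyperplanes -/

section GenericDegree

/-- The coefficients of the linear form given by the pairing with the given Plücker
coordinates. -/
def dualForm (w : Fin 6 → ℂ) : Fin 6 → ℂ := ![w 5, -w 4, w 3, w 2, -w 1, w 0]

theorem dualForm_dualForm (w : Fin 6 → ℂ) : dualForm (dualForm w) = w := by
  funext i
  fin_cases i <;> simp [dualForm]

theorem dualForm_ne_zero {w : Fin 6 → ℂ} (hw : w ≠ 0) : dualForm w ≠ 0 := by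
  intro h
  apply hw
  rw [← dualForm_dualForm w, h]
  funext i
  fin_cases i <;> simp [dualForm]

theorem dualForm_smul (c : ℂ) (w : Fin 6 → ℂ) : dualForm (c • w) = c • dualForm w := by
  funext i
  fin_cases i <;> simp [dualForm]

/-- A property of pairs of vectors holds generically if it holds where some nonzero polynomial does
not vanish. -/
def Generically (P : (Fin 4 → ℂ) → (Fin 4 → ℂ) → Prop) : Prop :=
  ∃ F : MvPolynomial (Fin 4 ⊕ Fin 4) ℂ, F ≠ 0 ∧ ∀ p u, eval (Sum.elim p u) F ≠ 0 → P p u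

theorem Generically.and {P Q : (Fin 4 → ℂ) → (Fin 4 → ℂ) → Prop} (hP : Generically P)
    (hQ : Generically Q) : Generically fun p u => P p u ∧ Q p u := by
  obtain ⟨F, hF, hP⟩ := hP
  obtain ⟨G, hG, hQ⟩ := hQ
  refine ⟨F * G, mul_ne_zero hF hG, fun p u h => ?_⟩
  rw [map_mul] at h
  exact ⟨hP p u (left_ne_zero_of_mul h), hQ p u (right_ne_zero_of_mul h)⟩

theorem Generically.exists {P : (Fin 4 → ℂ) → (Fin 4 → ℂ) → Prop} (hP : Generically P) :
    ∃ p u, P p u := by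
  obtain ⟨F, hF, hP⟩ := hP
  by_contra! h
  apply hF
  refine MvPolynomial.funext fun v => ?_
  rw [map_zero]
  by_contra h0
  refine h (v ∘ Sum.inl) (v ∘ Sum.inr) (hP _ _ ?_)
  rwa [Sum.elim_comp_inl_inr]

theorem exists_polynomial_wedge (i : Fin 6) :
    ∃ W : MvPolynomial (Fin 4 ⊕ Fin 4) ℂ, ∀ p u, eval (Sum.elim p u) W = wedge p u i := by
  have h : ∀ k l : Fin 4, ∃ W : MvPolynomial (Fin 4 ⊕ Fin 4) ℂ,
      ∀ p u, eval (Sum.elim p u) W = p k * u l - p l * u k := fun k l =>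
    ⟨X (Sum.inl k) * X (Sum.inr l) - X (Sum.inl l) * X (Sum.inr k), fun p u => by simp⟩
  fin_cases i
  exacts [h 0 1, h 0 2, h 0 3, h 1 2, h 1 3, h 2 3]

/-- Pulled back to the irreducible space of pairs of vectors, nonempty open conditions on
decomposable vectors can be imposed simultaneously. -/
theorem generically_wedge {F : MvPolynomial (Fin 6) ℂ} (h : ∃ p u, eval (wedge p u) F ≠ 0) :
    Generically fun p u => eval (wedge p u) F ≠ 0 := by
  choose W hW using exists_polynomial_wedge
  have hF : ∀ p u, eval (Sum.elim p u) (aeval W F) = eval (wedge p u) F := by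
    intro p u
    rw [← coe_aeval_eq_eval, ← coe_aeval_eq_eval, RingHom.coe_coe, RingHom.coe_coe,
      ← AlgHom.comp_apply, comp_aeval]
    congr 2
    funext i
    rw [← hW i p u, ← coe_aeval_eq_eval, RingHom.coe_coe]
  refine ⟨aeval W F, ?_, fun p u h => by rwa [hF] at h⟩
  rintro h0
  obtain ⟨p, u, h⟩ := h
  rw [← hF, h0, map_zero] at h
  exact h rfl

theorem exists_eval_dualForm (F : MvPolynomial (Fin 6) ℂ) :
    ∃ G : MvPolynomial (Fin 6) ℂ, ∀ w, eval w G = eval (dualForm w) F := by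
  refine ⟨aeval ![X 5, -X 4, X 3, X 2, -X 1, X 0] F, fun w => ?_⟩
  rw [← coe_aeval_eq_eval, ← coe_aeval_eq_eval, RingHom.coe_coe, RingHom.coe_coe,
    ← AlgHom.comp_apply, comp_aeval]
  congr 2
  funext i
  fin_cases i <;> simp [dualForm]

theorem generically_dualForm_wedge {F : MvPolynomial (Fin 6) ℂ}
    (h : ∃ p u, eval (dualForm (wedge p u)) F ≠ 0) :
    Generically fun p u => eval (dualForm (wedge p u)) F ≠ 0 := by
  obtain ⟨G, hG⟩ := exists_eval_dualForm F
  simp only [← hG] at h ⊢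
  exact generically_wedge h

/-- The Plücker vectors of the six coordinate lines form a basis, so no point lies on all special
hyperplanes. -/
theorem exists_dotProduct_dualForm_wedge_ne_zero {x : Fin 6 → ℂ} (hx : x ≠ 0) :
    ∃ p u, dualForm (wedge p u) ⬝ᵥ x ≠ 0 := by
  by_contra! h
  apply hx
  have h0 := h ![1, 0, 0, 0] ![0, 1, 0, 0]
  have h1 := h ![1, 0, 0, 0] ![0, 0, 1, 0]
  have h2 := h ![1, 0, 0, 0] ![0, 0, 0, 1]
  have h3 := h ![0, 1, 0, 0] ![0, 0, 1, 0]
  have h4 := h ![0, 1, 0, 0] ![0, 0, 0, 1]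
  have h5 := h ![0, 0, 1, 0] ![0, 0, 0, 1]
  simp [dualForm, wedge, dotProduct, Fin.sum_univ_succ] at h0 h1 h2 h3 h4 h5
  funext i
  fin_cases i
  exacts [h5, h4, h3, h2, h1, h0]

/-- `S` has exactly `d` points in a generic hyperplane, and also in the hyperplane of points which
correspond to lines that meet a generic line. -/
def HasGenericDegree (S : Set (Proj 6)) (d : ℕ) : Prop :=
  ∃ Δ : MvPolynomial (Fin 6) ℂ, (∃ p u, eval (dualForm (wedge p u)) Δ ≠ 0) ∧
    ∀ a, eval a Δ ≠ 0 → {x ∈ S | a ⬝ᵥ x.rep = 0}.encard = d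

theorem exists_polynomial_avoiding {E : Set (Proj 6)} (hE : E.Finite) :
    ∃ Δ : MvPolynomial (Fin 6) ℂ, (∃ p u, eval (dualForm (wedge p u)) Δ ≠ 0) ∧
      ∀ a, eval a Δ ≠ 0 → ∀ x ∈ E, a ⬝ᵥ x.rep ≠ 0 := by
  induction E, hE using Set.Finite.induction_on with
  | empty => exact ⟨1, ⟨0, 0, by simp⟩, by simp⟩
  | @insert x E _ _ ih =>
    obtain ⟨Δ, h1, h2⟩ := ih
    have h3 : ∃ p u, eval (dualForm (wedge p u)) (linForm x.rep) ≠ 0 := by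
      simp only [eval_linForm, dotProduct_comm x.rep]
      exact exists_dotProduct_dualForm_wedge_ne_zero x.rep_nonzero
    obtain ⟨p, u, h4, h5⟩ :=
      ((generically_dualForm_wedge h1).and (generically_dualForm_wedge h3)).exists
    refine ⟨Δ * linForm x.rep, ⟨p, u, by rw [map_mul]; exact mul_ne_zero h4 h5⟩, ?_⟩
    intro a ha y hy
    rw [map_mul] at ha
    rcases hy with rfl | hy
    · rw [dotProduct_comm, ← eval_linForm]
      exact right_ne_zero_of_mul ha
    · exact h2 a (left_ne_zero_of_mul ha) y hy

theorem HasGenericDegree.avoiding {S : Set (Proj 6)} {d : ℕ} (h : HasGenericDegree S d)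
    {E : Set (Proj 6)} (hE : E.Finite) :
    ∃ Δ : MvPolynomial (Fin 6) ℂ, (∃ p u, eval (dualForm (wedge p u)) Δ ≠ 0) ∧
      ∀ a, eval a Δ ≠ 0 → {x ∈ S | a ⬝ᵥ x.rep = 0}.encard = d ∧ ∀ x ∈ E, a ⬝ᵥ x.rep ≠ 0 := by
  obtain ⟨Δ, h1, h2⟩ := h
  obtain ⟨Δ', h3, h4⟩ := exists_polynomial_avoiding hE
  obtain ⟨p, u, h5, h6⟩ :=
    ((generically_dualForm_wedge h1).and (generically_dualForm_wedge h3)).exists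
  refine ⟨Δ * Δ', ⟨p, u, by rw [map_mul]; exact mul_ne_zero h5 h6⟩, fun a ha => ?_⟩
  rw [map_mul] at ha
  exact ⟨h2 a (left_ne_zero_of_mul ha), h4 a (right_ne_zero_of_mul ha)⟩

theorem hasGenericDegree_empty : HasGenericDegree ∅ 0 :=
  ⟨1, ⟨0, 0, by simp⟩, by simp⟩

theorem HasGenericDegree.congr {S T : Set (Proj 6)} {d : ℕ} (h : HasGenericDegree S d)
    (hST : (symmDiff S T).Finite) : HasGenericDegree T d := by
  obtain ⟨Δ, h1, h2⟩ := h.avoiding hST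
  refine ⟨Δ, h1, fun a ha => ?_⟩
  obtain ⟨h3, h4⟩ := h2 a ha
  rw [← h3]
  congr 1
  ext x
  constructor
  · rintro ⟨hx, hax⟩
    by_contra hc
    exact h4 x (Or.inr ⟨hx, fun hS => hc ⟨hS, hax⟩⟩) hax
  · rintro ⟨hx, hax⟩
    by_contra hc
    exact h4 x (Or.inl ⟨hx, fun hS => hc ⟨hS, hax⟩⟩) hax

theorem HasGenericDegree.union {S T : Set (Proj 6)} {d e : ℕ} (hS : HasGenericDegree S d)
    (hT : HasGenericDegree T e) (hST : (S ∩ T).Finite) : HasGenericDegree (S ∪ T) (d + e) := by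
  obtain ⟨Δ, h1, h2⟩ := hS.avoiding hST
  obtain ⟨Δ', h3, h4⟩ := hT
  obtain ⟨p, u, h5, h6⟩ :=
    ((generically_dualForm_wedge h1).and (generically_dualForm_wedge h3)).exists
  refine ⟨Δ * Δ', ⟨p, u, by rw [map_mul]; exact mul_ne_zero h5 h6⟩, fun a ha => ?_⟩
  rw [map_mul] at ha
  obtain ⟨h7, h8⟩ := h2 a (left_ne_zero_of_mul ha)
  have h9 := h4 a (right_ne_zero_of_mul ha)
  have hsep : {x ∈ S ∪ T | a ⬝ᵥ x.rep = 0}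
      = {x ∈ S | a ⬝ᵥ x.rep = 0} ∪ {x ∈ T | a ⬝ᵥ x.rep = 0} := by
    ext x
    simp only [Set.mem_union, Set.mem_ofPred_eq, or_and_right]
  rw [hsep, Set.encard_union_eq, h7, h9]
  · push_cast
    rfl
  · rw [Set.disjoint_left]
    rintro x ⟨hxS, hax⟩ ⟨hxT, -⟩
    exact h8 x ⟨hxS, hxT⟩ hax

theorem hasGenericDegree_biUnion {ι : Type*} (s : Finset ι) {X : ι → Set (Proj 6)}
    (h : ∀ i ∈ s, ∃ d, HasGenericDegree (X i) d)
    (hdis : ∀ i ∈ s, ∀ j ∈ s, i ≠ j → (X i ∩ X j).Finite) :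
    ∃ d, HasGenericDegree (⋃ i ∈ s, X i) d := by
  classical
  induction s using Finset.induction_on with
  | empty => exact ⟨0, by simpa using hasGenericDegree_empty⟩
  | @insert i s his ih =>
    obtain ⟨d, hd⟩ := ih (fun j hj => h j (Finset.mem_insert_of_mem hj))
      (fun j hj k hk => hdis j (Finset.mem_insert_of_mem hj) k (Finset.mem_insert_of_mem hk))
    obtain ⟨e, he⟩ := h i (Finset.mem_insert_self i s)
    refine ⟨e + d, ?_⟩
    rw [Finset.set_biUnion_insert]
    refine he.union hd ?_
    rw [Set.inter_iUnion₂]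
    refine s.finite_toSet.biUnion fun j hj => ?_
    exact hdis i (Finset.mem_insert_self i s) j (Finset.mem_insert_of_mem hj)
      fun h => his (h ▸ hj)

end GenericDegree

/-! ### Contraction of Plücker vectors with points -/

section IsotropicPencils

theorem wedge_add_smul_left (p u : Fin 4 → ℂ) (t : ℂ) : wedge (p + t • u) u = wedge p u := by
  funext i
  fin_cases i <;> simp [wedge] <;> ring

/-- The linear form `v ↦ dualForm (wedge p v) ⬝ᵥ x`. -/
def pairing (x : Fin 6 → ℂ) : (Fin 4 → ℂ) →ₗ[ℂ] (Fin 4 → ℂ) →ₗ[ℂ] ℂ :=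
  LinearMap.mk₂ ℂ (fun p v => dualForm (wedge p v) ⬝ᵥ x)
    (fun _ _ _ => by simp [dualForm, wedge, dotProduct, Fin.sum_univ_succ]; ring)
    (fun _ _ _ => by simp [dualForm, wedge, dotProduct, Fin.sum_univ_succ]; ring)
    (fun _ _ _ => by simp [dualForm, wedge, dotProduct, Fin.sum_univ_succ]; ring)
    (fun _ _ _ => by simp [dualForm, wedge, dotProduct, Fin.sum_univ_succ]; ring)

theorem pairing_apply (x : Fin 6 → ℂ) (p v : Fin 4 → ℂ) :
    pairing x p v = dualForm (wedge p v) ⬝ᵥ x := rfl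

theorem pairing_eq_zero {x : Fin 6 → ℂ} {p : Fin 4 → ℂ} (h : pairing x p = 0) :
    p 1 * x 5 - p 2 * x 4 + p 3 * x 3 = 0 ∧ p 3 * x 1 - p 2 * x 2 + p 0 * x 5 = 0 ∧
    -p 3 * x 0 + p 1 * x 2 - p 0 * x 4 = 0 ∧ p 2 * x 0 - p 1 * x 1 + p 0 * x 3 = 0 := by
  have h0 := LinearMap.congr_fun h ![1, 0, 0, 0]
  have h1 := LinearMap.congr_fun h ![0, 1, 0, 0]
  have h2 := LinearMap.congr_fun h ![0, 0, 1, 0]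
  have h3 := LinearMap.congr_fun h ![0, 0, 0, 1]
  simp [pairing_apply, dualForm, wedge, dotProduct, Fin.sum_univ_succ] at h0 h1 h2 h3
  refine ⟨?_, ?_, ?_, ?_⟩
  · linear_combination -h0
  · linear_combination h1
  · linear_combination h2
  · linear_combination h3

/-- `pairing x p = 0` means that `x ∧ p = 0`. A bivector killed by two independent vectors is a
multiple of their wedge; the conclusion expresses this by minors and is trivial for dependent ones.
-/
theorem mul_wedge_eq {x : Fin 6 → ℂ} {p u : Fin 4 → ℂ} (hp : pairing x p = 0)
    (hu : pairing x u = 0) (i j : Fin 6) : x i * wedge p u j = x j * wedge p u i := by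
  obtain ⟨a0, a1, a2, a3⟩ := pairing_eq_zero hp
  obtain ⟨b0, b1, b2, b3⟩ := pairing_eq_zero hu
  have key : ∀ i j : Fin 6, i < j → x i * wedge p u j = x j * wedge p u i := by
    clear hp hu
    intro i j hij
    fin_cases i <;> fin_cases j <;> simp at hij <;> simp [wedge] <;> grind
  rcases lt_trichotomy i j with h | rfl | h
  · exact key i j h
  · rfl
  · exact (key j i h).symm

end IsotropicPencils

/-! ### Irreducible curves in five-dimensional projective space -/

section DegreeOfCurves

theorem dotProduct_rep_mk_eq_zero {n : ℕ} (a : Fin n → ℂ) {v : Fin n → ℂ} (hv : v ≠ 0) :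
    a ⬝ᵥ (Projectivization.mk ℂ v hv).rep = 0 ↔ a ⬝ᵥ v = 0 := by
  obtain ⟨c, hc⟩ := Projectivization.exists_smul_eq_mk_rep ℂ v hv
  rw [← hc, Units.smul_def, dotProduct_smul, smul_eq_mul, mul_eq_zero, or_iff_right c.ne_zero]

/-- Choose a line through `p` and `u` whose Plücker point is off the curve and whose dual hyperplane
`a` misses `x₀`; then `a` meets the curve in finitely many points. Sliding `p` along the line does
not change `a`. After a suitable slide no point of `E` is killed by wedging with `p`, so a generic
`v` gives a second hyperplane that misses them all. -/
theorem exists_isotropic_pencil {J : Ideal (MvPolynomial (Fin 6) ℂ)} [J.IsPrime]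
    (hJ : IsHomIdeal J) (hd : HasDimLETwo J) (hne : (projZeros J).Nonempty) :
    ∃ p u v, linForm (dualForm (wedge p v)) ∉ J ∧ ∀ x ∈ zeros J,
      dualForm (wedge p v) ⬝ᵥ x = 0 → dualForm (wedge p u) ⬝ᵥ x = 0 → x = 0 := by
  obtain ⟨x₀, hx₀⟩ := hne
  -- The curve cannot contain the whole quadric: the lines through a coordinate point have three
  -- free Plücker coordinates, which satisfy no relation.
  have h1 : ∃ F ∈ J, ∃ p u, eval (wedge p u) F ≠ 0 := by
    obtain ⟨r, hr0, hr⟩ := hd ![X 0, X 1, X 2]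
    refine ⟨_, hr, ?_⟩
    by_contra! h
    apply hr0
    refine MvPolynomial.funext fun v => ?_
    rw [map_zero, ← h ![1, 0, 0, 0] ![0, v 0, v 1, v 2], ← coe_aeval_eq_eval, ← coe_aeval_eq_eval,
      RingHom.coe_coe, RingHom.coe_coe, ← AlgHom.comp_apply, comp_aeval]
    congr 2
    funext l
    fin_cases l <;> simp [wedge]
  obtain ⟨F, hFJ, hF⟩ := h1
  have h2 : ∃ p u, eval (dualForm (wedge p u)) (linForm x₀.rep) ≠ 0 := by
    simp only [eval_linForm, dotProduct_comm x₀.rep]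
    exact exists_dotProduct_dualForm_wedge_ne_zero x₀.rep_nonzero
  obtain ⟨p, u, hpu, hax⟩ := ((generically_wedge hF).and (generically_dualForm_wedge h2)).exists
  set w := wedge p u
  have hw : w ∉ zeros J := fun h => hpu (h F hFJ)
  rw [eval_linForm, dotProduct_comm] at hax
  have haJ : linForm (dualForm w) ∉ J := by
    intro h
    have := hx₀ _ h
    rw [eval_linForm] at this
    exact hax this
  have hfin := finite_projZeros_inter hJ hd haJ
  set E := insert x₀ {q ∈ projZeros J | ∀ c : ℂ, eval (c • q.rep) (linForm (dualForm w)) = 0}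
  have hE : E.Finite := hfin.insert x₀
  have hEJ : ∀ x ∈ E, x.rep ∈ zeros J := by
    rintro x (rfl | hx)
    · exact hx₀
    · exact hx.1
  have hpair : ∀ x ∈ E, pairing x.rep p = 0 → pairing x.rep u ≠ 0 := by
    intro x hx hp hu
    obtain ⟨i, hi⟩ := Function.ne_iff.mp x.rep_nonzero
    apply hw
    have : w = (w i * (x.rep i)⁻¹) • x.rep := by
      funext j
      have h3 := mul_wedge_eq hp hu i j
      have hi' : x.rep i ≠ 0 := hi
      simp only [Pi.smul_apply, smul_eq_mul]
      field_simp
      linear_combination h3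
    rw [this]
    exact smul_mem_zeros hJ (hEJ x hx) _
  -- Each point of `E` excludes at most one `r`: two exclusions would make it proportional to `w`,
  -- which is off the curve.
  have hbad : (⋃ x ∈ E, {r : ℂ | pairing x.rep (p + r • u) = 0}).Finite := by
    refine hE.biUnion fun x hx => Set.Subsingleton.finite ?_
    intro r hr s hs
    simp only [Set.mem_ofPred_eq, map_add, map_smul] at hr hs
    by_contra hrs
    have h3 : (r - s) • pairing x.rep u = 0 := by
      rw [sub_smul, sub_eq_zero]
      exact add_left_cancel (hr.trans hs.symm)
    have hu := (smul_eq_zero.mp h3).resolve_left (sub_ne_zero.mpr hrs)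
    rw [hu, smul_zero, add_zero] at hr
    exact hpair x hx hr hu
  obtain ⟨r, hr⟩ := hbad.exists_notMem
  simp only [Set.mem_iUnion, not_exists, Set.mem_ofPred_eq] at hr
  have := hE.to_subtype
  obtain ⟨v, hv⟩ := Module.Dual.exists_forall_ne_zero_of_forall_exists
    (fun x : E => (pairing x.1.rep (p + r • u) : Module.Dual ℂ (Fin 4 → ℂ))) (by
      intro x
      by_contra! h
      exact hr x.1 x.2 (LinearMap.ext h))
  refine ⟨p + r • u, u, v, ?_, ?_⟩
  · intro h
    have h3 := hx₀ _ h
    rw [eval_linForm] at h3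
    exact hv ⟨x₀, Set.mem_insert _ _⟩ h3
  · intro x hx hbx hax
    rw [wedge_add_smul_left] at hax
    by_contra hx0
    refine hv ⟨Projectivization.mk ℂ x hx0, Or.inr ⟨(rep_mk_mem_zeros hJ hx0).mpr hx, ?_⟩⟩
      ((dotProduct_rep_mk_eq_zero _ hx0).mpr hbx)
    intro c
    rw [eval_linForm, dotProduct_smul, (dotProduct_rep_mk_eq_zero _ hx0).mpr hax, smul_zero]

theorem exists_vector_dotProduct_ne_zero {n : ℕ} {ι : Type*} [Finite ι] (v : ι → Fin n → ℂ)
    (hv : ∀ i, v i ≠ 0) : ∃ c : Fin n → ℂ, ∀ i, c ⬝ᵥ v i ≠ 0 := by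
  obtain ⟨f, hf⟩ := Module.exists_dual_forall_apply_ne_zero (K := ℂ) v hv
  refine ⟨fun j => f (Pi.single j 1), fun i => ?_⟩
  convert hf i using 1
  rw [LinearMap.pi_apply_eq_sum_univ f (v i)]
  refine Finset.sum_congr rfl fun j _ => ?_
  rw [smul_eq_mul, mul_comm]
  change v i j * f (Pi.single j 1) = _
  congr 2
  funext k
  simp [Pi.single_apply, eq_comm]

theorem exists_hasGenericDegree {J : Ideal (MvPolynomial (Fin 6) ℂ)} [J.IsPrime]
    (hJ : IsHomIdeal J) (hd : HasDimLETwo J) (hinf : (projZeros J).Infinite) :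
    ∃ d, HasGenericDegree (projZeros J) d := by
  obtain ⟨p, u, v, hb, hab⟩ := exists_isotropic_pencil hJ hd hinf.nonempty
  set a := dualForm (wedge p u)
  set b := dualForm (wedge p v)
  have hE : {q ∈ projZeros J | b ⬝ᵥ q.rep = 0}.Finite := by
    refine (finite_projZeros_inter hJ hd hb).subset ?_
    rintro q ⟨h1, h2⟩
    refine ⟨h1, fun c => ?_⟩
    rw [eval_linForm, dotProduct_smul, h2, smul_zero]
  set E := {q ∈ projZeros J | b ⬝ᵥ q.rep = 0}
  obtain ⟨B, _, _, _, y, hy, hyb, hyJ, hpt⟩ := exists_chart hJ hb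
  have hdot : ∀ (φ : B →ₐ[ℂ] ℂ) (c : Fin 6 → ℂ), φ (linComb y c) = c ⬝ᵥ fun i => φ (y i) := by
    intro φ c
    simp [linComb, dotProduct]
  have hb1 : ∀ φ : B →ₐ[ℂ] ℂ, b ⬝ᵥ (fun i => φ (y i)) = 1 := by
    intro φ
    rw [← hdot, hyb, map_one]
  have h0 : ∀ φ : B →ₐ[ℂ] ℂ, (fun i => φ (y i)) ≠ 0 := by
    intro φ h
    have := hb1 φ
    rw [h, dotProduct_zero] at this
    exact zero_ne_one this
  have hz : ∀ φ : B →ₐ[ℂ] ℂ, (fun i => φ (y i)) ∈ zeros J := by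
    intro φ F hF
    rw [← coe_aeval_eq_eval, RingHom.coe_coe]
    have h1 : (aeval fun i => φ (y i)) = φ.comp (aeval y) := (comp_aeval y φ).symm
    rw [h1, AlgHom.comp_apply, hyJ F hF, map_zero]
  let Φ : (B →ₐ[ℂ] ℂ) → Proj 6 := fun φ => Projectivization.mk ℂ _ (h0 φ)
  have hcoord : ∀ φ ψ : B →ₐ[ℂ] ℂ, (∀ i, φ (y i) = ψ (y i)) → φ = ψ := by
    intro φ ψ h
    refine AlgHom.ext_of_adjoin_eq_top hy ?_
    rintro _ ⟨i, rfl⟩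
    exact h i
  have hΦ : Function.Injective Φ := by
    intro φ ψ h
    obtain ⟨c, hc⟩ := (Projectivization.mk_eq_mk_iff' ℂ _ _ (h0 φ) (h0 ψ)).mp h
    have h1 := hb1 φ
    rw [← hc, dotProduct_smul, hb1, smul_eq_mul, mul_one] at h1
    refine hcoord φ ψ fun i => ?_
    have h2 := congrFun hc i
    rw [h1, one_smul] at h2
    exact h2.symm
  have hΦJ : ∀ φ, Φ φ ∈ projZeros J := fun φ => (rep_mk_mem_zeros hJ (h0 φ)).mpr (hz φ)
  have hsurj : ∀ q ∈ projZeros J, q ∉ E → ∃ φ, Φ φ = q := by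
    intro q hq hqE
    have hbq : b ⬝ᵥ q.rep ≠ 0 := fun h => hqE ⟨hq, h⟩
    obtain ⟨φ, hφ⟩ := hpt ((b ⬝ᵥ q.rep)⁻¹ • q.rep) (smul_mem_zeros hJ hq _) (by
      rw [dotProduct_smul, smul_eq_mul, inv_mul_cancel₀ hbq])
    refine ⟨φ, ?_⟩
    conv_rhs => rw [← q.mk_rep]
    rw [Projectivization.mk_eq_mk_iff']
    exact ⟨(b ⬝ᵥ q.rep)⁻¹, (funext hφ).symm⟩
  have hhom : Infinite (B →ₐ[ℂ] ℂ) := by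
    rw [← not_finite_iff_infinite]
    intro hf
    refine hinf (((Set.finite_range Φ).union hE).subset ?_)
    intro q hq
    by_cases hqE : q ∈ E
    · exact Or.inr hqE
    · obtain ⟨φ, hφ⟩ := hsurj q hq hqE
      exact Or.inl ⟨φ, hφ⟩
  have ha : IsFiniteProjection y a := isFiniteProjection_of_no_common_zeros hJ hyJ hyb hab
  have hsep : ∀ s : Finset (B →ₐ[ℂ] ℂ), ∃ c, IsFiniteProjection y c ∧
      Set.InjOn (fun φ : B →ₐ[ℂ] ℂ => φ (linComb y c)) s := by
    intro s
    have := hE.to_subtype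
    -- Nonvanishing at the points of `E` makes `c` a finite projection; nonvanishing on differences
    -- of points makes it injective on `s`.
    obtain ⟨c, hc⟩ := exists_vector_dotProduct_ne_zero
      (ι := E ⊕ {z : s × s // z.1 ≠ z.2})
      (Sum.elim (fun q => q.1.rep) fun z i => z.1.1.1 (y i) - z.1.2.1 (y i)) (by
        rintro (q | z)
        · exact q.1.rep_nonzero
        · intro h
          apply z.2
          apply Subtype.ext
          exact hcoord _ _ fun i => sub_eq_zero.mp (congrFun h i))
    refine ⟨c, isFiniteProjection_of_no_common_zeros hJ hyJ hyb ?_, ?_⟩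
    · intro x hx hbx hcx
      by_contra hx0
      refine hc (Sum.inl ⟨Projectivization.mk ℂ x hx0, (rep_mk_mem_zeros hJ hx0).mpr hx,
        (dotProduct_rep_mk_eq_zero b hx0).mpr hbx⟩) ?_
      exact (dotProduct_rep_mk_eq_zero c hx0).mpr hcx
    · intro φ hφ ψ hψ h
      by_contra hne
      refine hc (Sum.inr ⟨(⟨φ, hφ⟩, ⟨ψ, hψ⟩), fun h2 => hne (congrArg Subtype.val h2)⟩) ?_
      change c ⬝ᵥ ((fun i => φ (y i)) - fun i => ψ (y i)) = 0
      rw [dotProduct_sub, ← hdot, ← hdot, sub_eq_zero]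
      exact h
  obtain ⟨e, Δ, t, hΔ, hcount⟩ := exists_discriminant hy ha hyb hsep
  obtain ⟨Δ', h3, h4⟩ := exists_polynomial_avoiding hE
  -- The two generators of the pencil share `p`, so every member is decomposable. Hence `Δ` is
  -- nonzero at a special hyperplane.
  have h5 : a - t • b = dualForm (wedge p (u - t • v)) := by
    funext i
    fin_cases i <;> simp [a, b, dualForm, wedge] <;> ring
  rw [h5] at hΔ
  obtain ⟨p', u', h6, h7⟩ :=
    ((generically_dualForm_wedge ⟨p, _, hΔ⟩).and (generically_dualForm_wedge h3)).exists
  refine ⟨e, Δ * Δ', ⟨p', u', by rw [map_mul]; exact mul_ne_zero h6 h7⟩, fun a' ha' => ?_⟩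
  rw [map_mul] at ha'
  have h8 := h4 a' (right_ne_zero_of_mul ha')
  rw [← hcount a' (left_ne_zero_of_mul ha'), ← hΦ.encard_image]
  congr 1
  ext q
  constructor
  · rintro ⟨hq, haq⟩
    obtain ⟨φ, rfl⟩ := hsurj q hq fun hqE => h8 q hqE haq
    refine ⟨φ, ?_, rfl⟩
    change φ (linComb y a') = 0
    rw [hdot]
    exact (dotProduct_rep_mk_eq_zero a' (h0 φ)).mp haq
  · rintro ⟨φ, hφ, rfl⟩
    refine ⟨hΦJ φ, (dotProduct_rep_mk_eq_zero a' (h0 φ)).mpr ?_⟩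
    rw [← hdot]
    exact hφ

end DegreeOfCurves

/-! ### From Krull dimension to algebraic dependence -/

section Dimension

/-- Noether normalisation makes the quotient integral over a polynomial ring in `s` variables.
Going-up lifts chains of primes, so `s ≤ 2`, which bounds the transcendence degree. -/
theorem hasDimLETwo_of_ringKrullDim_eq {n : ℕ} {P : Ideal (MvPolynomial (Fin n) ℂ)} [P.IsPrime]
    (h : ringKrullDim (MvPolynomial (Fin n) ℂ ⧸ P) = 2) : HasDimLETwo P := by
  obtain ⟨s, g, hg, hint⟩ := exists_integral_inj_algHom_of_fg ℂ (MvPolynomial (Fin n) ℂ ⧸ P)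
  algebraize [g.toRingHom]
  have hgi : Function.Injective
      (algebraMap (MvPolynomial (Fin s) ℂ) (MvPolynomial (Fin n) ℂ ⧸ P)) := hg
  have : FaithfulSMul (MvPolynomial (Fin s) ℂ) (MvPolynomial (Fin n) ℂ ⧸ P) :=
    (faithfulSMul_iff_algebraMap_injective _ _).mpr hgi
  have : IsScalarTower ℂ (MvPolynomial (Fin s) ℂ) (MvPolynomial (Fin n) ℂ ⧸ P) :=
    IsScalarTower.of_algebraMap_eq fun x => (g.commutes x).symm
  have : Algebra.IsIntegral (MvPolynomial (Fin s) ℂ) (MvPolynomial (Fin n) ℂ ⧸ P) := ⟨hint⟩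
  have hs : s ≤ 2 := by
    have h1 : (ringKrullDim (MvPolynomial (Fin s) ℂ)) = s := by
      rw [MvPolynomial.ringKrullDim_of_isNoetherianRing, ringKrullDim_eq_zero_of_field]
      simp
    have h2 : ringKrullDim (MvPolynomial (Fin s) ℂ) ≤ 2 := by
      refine iSup_le fun l => ?_
      obtain ⟨P', hP', hlo⟩ := Ideal.exists_ideal_over_prime_of_isIntegral
        (S := MvPolynomial (Fin n) ℂ ⧸ P) l.head.asIdeal ⊥ (by
          rw [← RingHom.ker_eq_comap_bot, (RingHom.injective_iff_ker_eq_bot _).mp hgi]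
          exact bot_le)
      have hlo' : P'.LiesOver l.head.asIdeal := ⟨hlo.2.symm⟩
      have := hlo.1
      obtain ⟨L, hL, -⟩ := Ideal.exists_ltSeries_of_hasGoingUp l P'
      rw [← h, ← hL]
      exact le_iSup (fun p : LTSeries (PrimeSpectrum (MvPolynomial (Fin n) ℂ ⧸ P)) =>
        ((p.length : ℕ∞) : WithBot ℕ∞)) L
    rw [h1] at h2
    exact_mod_cast h2
  have htr : Algebra.trdeg ℂ (MvPolynomial (Fin n) ℂ ⧸ P) ≤ 2 := by
    rw [← trdeg_add_eq ℂ (MvPolynomial (Fin s) ℂ), MvPolynomial.trdeg_of_isDomain,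
      trdeg_eq_zero]
    simpa using mod_cast hs
  intro f
  by_contra! hf
  have hind : AlgebraicIndependent ℂ fun i => Ideal.Quotient.mk P (f i) := by
    rw [algebraicIndependent_iff]
    intro r hr
    by_contra h0
    refine hf r h0 (Ideal.Quotient.eq_zero_iff_mem.mp ?_)
    rw [← hr, ← Ideal.Quotient.mkₐ_eq_mk ℂ, ← AlgHom.comp_apply, comp_aeval]
  have h3 := hind.cardinalMk_le_trdeg.trans htr
  have h4 : (3 : Cardinal) ≤ 2 := by simpa using h3
  exact absurd h4 (by norm_num)

end Dimension

/-! ### Lifting points by Chevalley's theorem -/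

section Extension

variable {m n : ℕ}

theorem exists_mem_zeros_eval_ne_zero {q : Ideal (MvPolynomial (Fin n) ℂ)} [q.IsPrime]
    {h : MvPolynomial (Fin n) ℂ} (hh : h ∉ q) : ∃ v ∈ zeros q, eval v h ≠ 0 := by
  by_contra! h0
  apply hh
  have h1 : h ∈ vanishingIdeal ℂ (zeroLocus ℂ q) := by
    intro v hv
    exact h0 v fun F hF => hv F hF
  rwa [vanishingIdeal_zeroLocus_eq_radical, Ideal.IsPrime.radical ‹_›] at h1

/-- Points of the closure of the image of an affine variety lift, outside of a proper closed
subset, to points of a given nonempty open subset of that variety. -/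
theorem exists_lift_of_eval_ne_zero (ψ : Fin m → MvPolynomial (Fin n) ℂ)
    {P : Ideal (MvPolynomial (Fin n) ℂ)} [P.IsPrime] {h : MvPolynomial (Fin n) ℂ} (hh : h ∉ P) :
    ∃ g ∉ P.comap (aeval ψ), ∀ y ∈ zeros (P.comap (aeval ψ)), eval y g ≠ 0 →
      ∃ v ∈ zeros P, eval v h ≠ 0 ∧ ∀ i, eval v (ψ i) = y i := by
  let f : MvPolynomial (Fin m) ℂ →+* MvPolynomial (Fin n) ℂ := (aeval ψ).toRingHom
  have hf : f.FinitePresentation := by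
    apply RingHom.FinitePresentation.of_finiteType.mp
    refine RingHom.FiniteType.of_comp_finiteType (f := algebraMap ℂ (MvPolynomial (Fin m) ℂ)) ?_
    have : f.comp (algebraMap ℂ _) = algebraMap ℂ (MvPolynomial (Fin n) ℂ) :=
      (aeval ψ).comp_algebraMap
    rw [this, RingHom.finiteType_algebraMap]
    infer_instance
  have hs : Topology.IsConstructible ((PrimeSpectrum.basicOpen h : Set (PrimeSpectrum _)) ∩
      PrimeSpectrum.zeroLocus (P : Set (MvPolynomial (Fin n) ℂ))) := by
    refine PrimeSpectrum.isConstructible_basicOpen.inter ?_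
    rw [← Topology.isConstructible_compl]
    exact (PrimeSpectrum.isRetrocompact_zeroLocus_compl_of_fg
      (IsNoetherian.noetherian P)).isConstructible (PrimeSpectrum.isClosed_zeroLocus _).isOpen_compl
  obtain ⟨S, hS⟩ := PrimeSpectrum.exists_constructibleSetData_iff.mpr
    (PrimeSpectrum.isConstructible_comap_image hf hs)
  have h1 : PrimeSpectrum.comap f ⟨P, ‹_›⟩ ∈ S.toSet := by
    rw [hS]
    exact ⟨_, ⟨hh, fun _ hx => hx⟩, rfl⟩
  simp only [PrimeSpectrum.ConstructibleSetData.toSet, Set.mem_iUnion] at h1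
  -- The constructible image contains the generic point of its closure, so one locally closed piece
  -- does; its open condition `c.f` serves as `g`.
  obtain ⟨c, hc, hcP⟩ := h1
  refine ⟨c.f, fun h2 => hcP.2 fun x hx => ?_, fun y hy hyf => ?_⟩
  · rw [Set.mem_singleton_iff.mp hx]
    exact h2
  have hmax : (vanishingIdeal ℂ {y} : Ideal (MvPolynomial (Fin m) ℂ)).IsMaximal := inferInstance
  have hmem : ∀ F : MvPolynomial (Fin m) ℂ, F ∈ vanishingIdeal ℂ {y} ↔ eval y F = 0 := by
    intro F
    rw [mem_vanishingIdeal_singleton_iff]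
    rfl
  have h2 : (⟨vanishingIdeal ℂ {y}, hmax.isPrime⟩ : PrimeSpectrum (MvPolynomial (Fin m) ℂ))
      ∈ S.toSet := by
    simp only [PrimeSpectrum.ConstructibleSetData.toSet, Set.mem_iUnion]
    refine ⟨c, hc, fun x hx => ?_, fun h3 => hyf ((hmem _).mp (h3 rfl))⟩
    exact (hmem x).mpr (hy x (hcP.1 hx))
  rw [hS] at h2
  -- A prime over the maximal ideal of `y` suffices: every zero of `q` maps to `y`, and one of them
  -- has `h` nonzero.
  obtain ⟨⟨q, hq⟩, ⟨hqh, hqP⟩, hqy⟩ := h2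
  obtain ⟨v, hv, hvh⟩ := exists_mem_zeros_eval_ne_zero (q := q) hqh
  refine ⟨v, fun F hF => hv F (hqP hF), hvh, fun i => ?_⟩
  have h3 : (X i - C (y i) : MvPolynomial (Fin m) ℂ) ∈ q.comap f := by
    have h4 : q.comap f = vanishingIdeal ℂ {y} := congrArg PrimeSpectrum.asIdeal hqy
    rw [h4, hmem]
    simp
  have h5 := hv _ (Ideal.mem_comap.mp h3)
  simpa [f, sub_eq_zero] using h5

end Extension

/-! ### Irreducible components of projective sets -/

section HomogeneousPrimes

variable {n : ℕ}

/-- The homogeneous core of a prime is prime and still contains the homogeneous ideal `I`, so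
minimality forces equality. -/
theorem IsHomIdeal.of_mem_minimalPrimes {I P : Ideal (MvPolynomial (Fin n) ℂ)}
    (hI : IsHomIdeal I) (hP : P ∈ I.minimalPrimes) : IsHomIdeal P := by
  classical
  let _ := MvPolynomial.gradedAlgebra (σ := Fin n) (R := ℂ)
  have hprime : P.IsPrime := hP.1.1
  have hdec : ∀ (F : MvPolynomial (Fin n) ℂ) (k : ℕ),
      (DirectSum.decompose (homogeneousSubmodule (Fin n) ℂ) F k : MvPolynomial (Fin n) ℂ)
        = homogeneousComponent k F := fun F k => by
    exact decomposition.decompose'_apply F k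
  have h1 : I ≤ (P.homogeneousCore (homogeneousSubmodule (Fin n) ℂ)).toIdeal := by
    intro F hF
    rw [← sum_homogeneousComponent F]
    refine Ideal.sum_mem _ fun k _ => ?_
    exact Ideal.mem_homogeneousCore_of_homogeneous_of_mem
      ⟨k, homogeneousComponent_isHomogeneous k F⟩ (hP.1.2 (hI F hF k))
  have h2 : P ≤ (P.homogeneousCore (homogeneousSubmodule (Fin n) ℂ)).toIdeal :=
    hP.2 ⟨hprime.homogeneousCore, h1⟩ (Ideal.toIdeal_homogeneousCore_le _ P)
  intro F hF k
  have h3 := (P.homogeneousCore (homogeneousSubmodule (Fin n) ℂ)).isHomogeneous k (h2 hF)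
  rw [hdec] at h3
  exact Ideal.toIdeal_homogeneousCore_le _ P h3

theorem mem_zeros_iff_exists_minimalPrimes {I : Ideal (MvPolynomial (Fin n) ℂ)} {v : Fin n → ℂ} :
    v ∈ zeros I ↔ ∃ P ∈ I.minimalPrimes, v ∈ zeros P := by
  constructor
  · intro hv
    have hmax : (vanishingIdeal ℂ {v} : Ideal (MvPolynomial (Fin n) ℂ)).IsMaximal := inferInstance
    have := hmax.isPrime
    obtain ⟨P, hP, hPv⟩ := Ideal.exists_minimalPrimes_le (I := I) (J := vanishingIdeal ℂ {v})
      fun F hF => (mem_vanishingIdeal_singleton_iff ..).mpr (hv F hF)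
    exact ⟨P, hP, fun F hF => (mem_vanishingIdeal_singleton_iff ..).mp (hPv hF)⟩
  · rintro ⟨P, hP, hv⟩ F hF
    exact hv F (hP.1.2 hF)

theorem smul_mem_cone {X : Set (Proj n)} {v : Fin n → ℂ} (hv : v ∈ cone X) {c : ℂ} (hc : c ≠ 0) :
    c • v ∈ cone X := by
  obtain ⟨h, hX⟩ := hv
  refine ⟨smul_ne_zero hc h, ?_⟩
  convert hX using 1
  exact (Projectivization.mk_eq_mk_iff' ..).mpr ⟨c, rfl⟩

theorem mem_projIdeal {X : Set (Proj n)} {F : MvPolynomial (Fin n) ℂ} :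
    F ∈ projIdeal X ↔ ∀ v ∈ cone X, eval v F = 0 := Iff.rfl

theorem isHomIdeal_projIdeal (X : Set (Proj n)) : IsHomIdeal (projIdeal X) := fun _ hF k v hv =>
  eval_homogeneousComponent_eq_zero (fun _ hc => mem_projIdeal.mp hF _ (smul_mem_cone hv hc)) k

theorem mem_cone_iff_of_isZariskiClosed {X : Set (Proj n)} (hX : IsZariskiClosed X)
    {v : Fin n → ℂ} (hv : v ≠ 0) : v ∈ cone X ↔ v ∈ zeros (projIdeal X) := by
  refine ⟨fun h F hF => mem_projIdeal.mp hF v h, fun h => ⟨hv, ?_⟩⟩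
  obtain ⟨S, hS, rfl⟩ := hX
  have key : ∀ F ∈ S, ∀ w : Fin n → ℂ, ∀ hw : w ≠ 0,
      eval (Projectivization.mk ℂ w hw).rep F = 0 ↔ eval w F = 0 := by
    intro F hF w hw
    obtain ⟨k, hk⟩ := hS F hF
    obtain ⟨a, ha⟩ := Projectivization.exists_smul_eq_mk_rep ℂ w hw
    rw [← ha, Units.smul_def, eval_smul_of_isHomogeneous hk]
    simp
  intro F hF
  rw [key F hF v hv]
  refine h F fun w hw => ?_
  exact (key F hF w hw.1).mp (hw.2 F hF)

theorem mem_iff_exists_minimalPrimes {X : Set (Proj n)} (hX : IsZariskiClosed X) {p : Proj n} :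
    p ∈ X ↔ ∃ P ∈ (projIdeal X).minimalPrimes, p ∈ projZeros P := by
  have h : p ∈ X ↔ p.rep ∈ cone X := by simp [cone, p.rep_nonzero]
  rw [h, mem_cone_iff_of_isZariskiClosed hX p.rep_nonzero, mem_zeros_iff_exists_minimalPrimes]
  rfl

end HomogeneousPrimes

/-! ### Images of curves under rational maps -/

section Image

variable {m n : ℕ}

/-- The image of a projective variety under a rational map. -/
def imagePoints (P : Ideal (MvPolynomial (Fin n) ℂ)) (ψ : Fin m → MvPolynomial (Fin n) ℂ) :
    Set (Proj m) :=
  {q | ∃ v ∈ zeros P, v ≠ 0 ∧ ∃ h : (fun i => eval v (ψ i)) ≠ 0, q = Projectivization.mk ℂ _ h}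

/-- A set of points is a curve up to finitely many points if it coincides, outside of a finite set,
with an infinite irreducible closed set of dimension one containing it. -/
def IsCurveUpToFinite (S : Set (Proj n)) (J : Ideal (MvPolynomial (Fin n) ℂ)) : Prop :=
  J.IsPrime ∧ IsHomIdeal J ∧ HasDimLETwo J ∧ (projZeros J).Infinite ∧ S ⊆ projZeros J ∧
    (projZeros J \ S).Finite

/-- The closure of the image is the zero set of the pulled back prime `J`, whose dimension is no
larger. The image contains a nonempty open part of it, and a proper closed subset of a curve is
finite. -/
theorem imagePoints_finite_or {P : Ideal (MvPolynomial (Fin n) ℂ)} [P.IsPrime] (hP : IsHomIdeal P)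
    (hd : HasDimLETwo P) {ψ : Fin m → MvPolynomial (Fin n) ℂ} {δ : ℕ}
    (hψ : ∀ i, (ψ i).IsHomogeneous δ) :
    (imagePoints P ψ).Finite ∨ ∃ J, IsCurveUpToFinite (imagePoints P ψ) J := by
  by_cases hψP : ∀ i, ψ i ∈ P
  · left
    convert Set.finite_empty
    rw [Set.eq_empty_iff_forall_notMem]
    rintro _ ⟨v, hv, -, h, -⟩
    exact h (funext fun i => hv _ (hψP i))
  push Not at hψP
  obtain ⟨i, hi⟩ := hψP
  have hscale : ∀ (c : ℂ) (v : Fin n → ℂ),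
      (fun i => eval (c • v) (ψ i)) = c ^ δ • fun i => eval v (ψ i) := fun c v =>
    funext fun i => eval_smul_of_isHomogeneous (hψ i) c v
  -- Forms of degree zero are constant, so the image is at most one point. Positive degree is needed
  -- to rescale targets by roots and to lift to nonzero vectors.
  rcases Nat.eq_zero_or_pos δ with rfl | hδ
  · left
    refine Set.Subsingleton.finite ?_
    rintro _ ⟨v, hv, -, h, rfl⟩ _ ⟨w, hw, -, h', rfl⟩
    rw [Projectivization.mk_eq_mk_iff']
    refine ⟨1, ?_⟩
    have h1 := hscale 0 v
    have h2 := hscale 0 w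
    simp only [zero_smul, pow_zero, one_smul] at h1 h2
    rw [one_smul, ← h1, ← h2]
  let J := P.comap (aeval (R := ℂ) ψ)
  have hJP : J.IsPrime := inferInstance
  have hev : ∀ (v : Fin n → ℂ) (F : MvPolynomial (Fin m) ℂ),
      eval v (aeval ψ F) = eval (fun i => eval v (ψ i)) F := by
    intro v F
    change aeval v (aeval ψ F) = _
    rw [← AlgHom.comp_apply, comp_aeval]
    rfl
  have hmem : ∀ F, F ∈ J ↔ ∀ v ∈ zeros P, eval (fun i => eval v (ψ i)) F = 0 := by
    intro F
    simp only [← hev]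
    refine ⟨fun h v hv => hv _ h, fun h => ?_⟩
    by_contra h0
    obtain ⟨v, hv, h1⟩ := exists_mem_zeros_eval_ne_zero (q := P) h0
    exact h1 (h v hv)
  have hJ : IsHomIdeal J := by
    intro F hF k
    rw [hmem] at hF ⊢
    intro v hv
    refine eval_homogeneousComponent_eq_zero (fun c _ => ?_) k
    obtain ⟨s, hs⟩ := IsAlgClosed.exists_pow_nat_eq c hδ
    rw [← hs, ← hscale]
    exact hF _ (smul_mem_zeros hP hv s)
  have hJd : HasDimLETwo J := by
    intro f
    obtain ⟨r, hr, h⟩ := hd fun i => aeval ψ (f i)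
    refine ⟨r, hr, ?_⟩
    change aeval ψ (aeval f r) ∈ P
    rwa [← AlgHom.comp_apply, comp_aeval]
  have hsub : imagePoints P ψ ⊆ projZeros J := by
    rintro _ ⟨v, hv, -, h, rfl⟩
    rw [rep_mk_mem_zeros hJ]
    exact fun F hF => (hmem F).mp hF v hv
  obtain ⟨g, hg, hlift⟩ := exists_lift_of_eval_ne_zero ψ hi
  have hfin : (projZeros J \ imagePoints P ψ).Finite := by
    refine (finite_projZeros_inter hJ hJd hg).subset ?_
    rintro p ⟨hp, hpS⟩
    refine ⟨hp, fun c => ?_⟩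
    by_contra hc
    obtain ⟨v, hv, hvi, hvp⟩ := hlift (c • p.rep) (smul_mem_zeros hJ hp c) hc
    have h1 : (fun i => eval v (ψ i)) = c • p.rep := funext hvp
    have h0 : (fun i => eval v (ψ i)) ≠ 0 := fun h => hvi (congrFun h i)
    have hv0 : v ≠ 0 := by
      rintro rfl
      have h2 := hscale 0 0
      rw [smul_zero, zero_pow hδ.ne', zero_smul] at h2
      exact h0 h2
    refine hpS ⟨v, hv, hv0, h0, ?_⟩
    rw [← p.mk_rep, Projectivization.mk_eq_mk_iff']
    have hc0 : c ≠ 0 := by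
      rintro rfl
      exact h0 (by rw [h1, zero_smul])
    refine ⟨c⁻¹, ?_⟩
    rw [h1, smul_smul, inv_mul_cancel₀ hc0, one_smul]
  by_cases hinf : (projZeros J).Infinite
  · exact Or.inr ⟨J, hJP, hJ, hJd, hinf, hsub, hfin⟩
  · exact Or.inl ((Set.not_infinite.mp hinf).subset hsub)

end Image

/-! ### Finite unions of curves and their closures -/

section UnionOfCurves

variable {n : ℕ}

theorem IsZariskiClosed.union {X Y : Set (Proj n)} (hX : IsZariskiClosed X)
    (hY : IsZariskiClosed Y) : IsZariskiClosed (X ∪ Y) := by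
  obtain ⟨S, hS, rfl⟩ := hX
  obtain ⟨T, hT, rfl⟩ := hY
  refine ⟨{H | ∃ F ∈ S, ∃ G ∈ T, H = F * G}, ?_, ?_⟩
  · rintro _ ⟨F, hF, G, hG, rfl⟩
    obtain ⟨k, hk⟩ := hS F hF
    obtain ⟨l, hl⟩ := hT G hG
    exact ⟨k + l, hk.mul hl⟩
  · ext p
    constructor
    · rintro (h | h) _ ⟨F, hF, G, hG, rfl⟩
      · rw [map_mul, h F hF, zero_mul]
      · rw [map_mul, h G hG, mul_zero]
    · intro h
      by_contra! h0
      simp only [Set.mem_union, Set.mem_ofPred_eq, not_or, not_forall] at h0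
      obtain ⟨⟨F, hF, hF0⟩, ⟨G, hG, hG0⟩⟩ := h0
      have := h _ ⟨F, hF, G, hG, rfl⟩
      rw [map_mul] at this
      exact mul_ne_zero hF0 hG0 this

theorem isZariskiClosed_empty : IsZariskiClosed (∅ : Set (Proj n)) :=
  ⟨{1}, by rintro _ rfl; exact ⟨0, isHomogeneous_one _ _⟩, by ext; simp⟩

theorem isZariskiClosed_biUnion {ι : Type*} (s : Finset ι) {X : ι → Set (Proj n)}
    (h : ∀ i ∈ s, IsZariskiClosed (X i)) : IsZariskiClosed (⋃ i ∈ s, X i) := by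
  classical
  induction s using Finset.induction_on with
  | empty => simpa using isZariskiClosed_empty
  | insert i s _ ih =>
    rw [Finset.set_biUnion_insert]
    exact (h i (Finset.mem_insert_self i s)).union
      (ih fun j hj => h j (Finset.mem_insert_of_mem hj))

theorem isZariskiClosed_projZeros {J : Ideal (MvPolynomial (Fin n) ℂ)} (hJ : IsHomIdeal J) :
    IsZariskiClosed (projZeros J) := by
  refine ⟨{F | F ∈ J ∧ ∃ k, F.IsHomogeneous k}, fun F hF => hF.2, ?_⟩
  ext p
  refine ⟨fun h F hF => h F hF.1, fun h F hF => ?_⟩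
  rw [← sum_homogeneousComponent F, map_sum]
  exact Finset.sum_eq_zero fun k _ => h _ ⟨hJ F hF k, k, homogeneousComponent_isHomogeneous k F⟩

theorem isZariskiClosed_singleton (p : Proj n) : IsZariskiClosed {p} := by
  refine ⟨Set.range fun ij : Fin n × Fin n =>
    C (p.rep ij.1) * X ij.2 - C (p.rep ij.2) * X ij.1, ?_, ?_⟩
  · rintro _ ⟨⟨i, j⟩, rfl⟩
    exact ⟨1, (isHomogeneous_C_mul_X _ _).sub (isHomogeneous_C_mul_X _ _)⟩
  · ext q
    constructor
    · rintro rfl _ ⟨⟨i, j⟩, rfl⟩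
      simp [mul_comm]
    · intro h
      obtain ⟨i, hi⟩ := Function.ne_iff.mp p.rep_nonzero
      have hi' : p.rep i ≠ 0 := hi
      rw [Set.mem_singleton_iff, ← q.mk_rep, ← p.mk_rep, Projectivization.mk_eq_mk_iff']
      refine ⟨q.rep i / p.rep i, funext fun j => ?_⟩
      have h1 := h _ ⟨⟨i, j⟩, rfl⟩
      simp only [map_sub, map_mul, eval_C, eval_X, sub_eq_zero] at h1
      simp only [Pi.smul_apply, smul_eq_mul]
      field_simp
      linear_combination -h1

theorem _root_.Set.Finite.isZariskiClosed {E : Set (Proj n)} (hE : E.Finite) :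
    IsZariskiClosed E := by
  convert isZariskiClosed_biUnion hE.toFinset (X := fun p => {p})
    fun p _ => isZariskiClosed_singleton p
  ext; simp

theorem finite_projZeros_inter_projZeros {J J' : Ideal (MvPolynomial (Fin n) ℂ)} [J.IsPrime]
    [J'.IsPrime] (hJ : IsHomIdeal J) (hJ' : IsHomIdeal J') (hd : HasDimLETwo J)
    (hd' : HasDimLETwo J') (hne : J ≠ J') : (projZeros J ∩ projZeros J').Finite := by
  by_cases h : J' ≤ J
  · have h2 : ¬J ≤ J' := fun h3 => hne (le_antisymm h3 h)
    obtain ⟨G, hG, hG'⟩ := SetLike.not_le_iff_exists.mp h2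
    refine (finite_projZeros_inter hJ' hd' hG').subset ?_
    exact fun p hp => ⟨hp.2, fun c => smul_mem_zeros hJ hp.1 c G hG⟩
  · obtain ⟨G, hG, hG'⟩ := SetLike.not_le_iff_exists.mp h
    refine (finite_projZeros_inter hJ hd hG').subset ?_
    exact fun p hp => ⟨hp.1, fun c => smul_mem_zeros hJ' hp.2 c G hG⟩

/-- Indexing by ideals merges pieces with the same closure, so that distinct members meet in
finitely many points and their counts add. -/
theorem exists_union_projZeros {ι : Type*} (s : Finset ι) {S : ι → Set (Proj n)}
    (h : ∀ i ∈ s, (S i).Finite ∨ ∃ J, IsCurveUpToFinite (S i) J) :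
    ∃ 𝒥 : Finset (Ideal (MvPolynomial (Fin n) ℂ)),
      (∀ J ∈ 𝒥, J.IsPrime ∧ IsHomIdeal J ∧ HasDimLETwo J ∧ (projZeros J).Infinite) ∧
      (symmDiff (⋃ i ∈ s, S i) (⋃ J ∈ 𝒥, projZeros J)).Finite := by
  classical
  induction s using Finset.induction_on with
  | empty => exact ⟨∅, by simp, by simp⟩
  | insert i s _ ih =>
    obtain ⟨𝒥, h1, h2⟩ := ih fun j hj => h j (Finset.mem_insert_of_mem hj)
    rcases h i (Finset.mem_insert_self i s) with h3 | ⟨J, hp, hJ, hd, hinf, hsub, hfin⟩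
    · refine ⟨𝒥, h1, (h2.union h3).subset ?_⟩
      rw [Finset.set_biUnion_insert]
      rintro p (⟨hp | hp, hp'⟩ | ⟨hp, hp'⟩)
      · exact Or.inr hp
      · exact Or.inl (Or.inl ⟨hp, hp'⟩)
      · exact Or.inl (Or.inr ⟨hp, fun h4 => hp' (Or.inr h4)⟩)
    · refine ⟨insert J 𝒥, ?_, (h2.union hfin).subset ?_⟩
      · simp only [Finset.mem_insert, forall_eq_or_imp]
        exact ⟨⟨hp, hJ, hd, hinf⟩, h1⟩
      · rw [Finset.set_biUnion_insert, Finset.set_biUnion_insert]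
        rintro p (⟨hp | hp, hp'⟩ | ⟨hp | hp, hp'⟩)
        · exact absurd (Or.inl (hsub hp)) hp'
        · exact Or.inl (Or.inl ⟨hp, fun h4 => hp' (Or.inr h4)⟩)
        · exact Or.inr ⟨hp, fun h4 => hp' (Or.inl h4)⟩
        · exact Or.inl (Or.inr ⟨hp, fun h4 => hp' (Or.inr h4)⟩)

/-- The limit curves together with the finite symmetric difference form a closed set containing the
union, and it exceeds the union by finitely many points. -/
theorem finite_zariskiClosure_diff {ι : Type*} (s : Finset ι) {S : ι → Set (Proj n)}
    (h : ∀ i ∈ s, (S i).Finite ∨ ∃ J, IsCurveUpToFinite (S i) J) :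
    (zariskiClosure (⋃ i ∈ s, S i) \ ⋃ i ∈ s, S i).Finite := by
  obtain ⟨𝒥, h1, h2⟩ := exists_union_projZeros s h
  refine h2.subset ?_
  have hcl : IsZariskiClosed ((⋃ J ∈ 𝒥, projZeros J) ∪ symmDiff (⋃ i ∈ s, S i)
      (⋃ J ∈ 𝒥, projZeros J)) :=
    (isZariskiClosed_biUnion 𝒥 fun J hJ => isZariskiClosed_projZeros (h1 J hJ).2.1).union
      h2.isZariskiClosed
  rintro p ⟨hp, hpS⟩
  have h3 : p ∈ (⋃ J ∈ 𝒥, projZeros J) ∪ symmDiff (⋃ i ∈ s, S i) (⋃ J ∈ 𝒥, projZeros J) := by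
    refine hp _ ⟨hcl, fun q hq => ?_⟩
    by_cases hq' : q ∈ ⋃ J ∈ 𝒥, projZeros J
    · exact Or.inl hq'
    · exact Or.inr (Or.inl ⟨hq, hq'⟩)
  exact h3.elim (fun h4 => Or.inr ⟨h4, hpS⟩) id

theorem exists_hasGenericDegree_biUnion {ι : Type*} (s : Finset ι) {S : ι → Set (Proj 6)}
    (h : ∀ i ∈ s, (S i).Finite ∨ ∃ J, IsCurveUpToFinite (S i) J) :
    ∃ d, HasGenericDegree (⋃ i ∈ s, S i) d := by
  obtain ⟨𝒥, h1, h2⟩ := exists_union_projZeros s h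
  obtain ⟨d, hd⟩ := hasGenericDegree_biUnion 𝒥 (X := fun J => projZeros J)
    (fun J hJ => by
      obtain ⟨hp, hJ, hd, hinf⟩ := h1 J hJ
      exact exists_hasGenericDegree hJ hd hinf)
    (fun J hJ J' hJ' hne => by
      obtain ⟨hp, hJ, hd, -⟩ := h1 J hJ
      obtain ⟨hp', hJ', hd', -⟩ := h1 J' hJ'
      exact finite_projZeros_inter_projZeros hJ hJ' hd hd' hne)
  exact ⟨d, hd.congr (by rwa [symmDiff_comm])⟩

end UnionOfCurves

/-! ### Lines given by two linear equations -/

section Annihilators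

theorem linearIndependent_of_wedge_ne_zero {u v : Fin 4 → ℂ} (h : wedge u v ≠ 0) :
    LinearIndependent ℂ ![u, v] := by
  rw [LinearIndependent.pair_iff]
  intro s t hst
  have h1 : s • wedge u v = wedge (s • u + t • v) v := by
    funext i
    fin_cases i <;> simp [wedge] <;> ring
  have h2 : t • wedge u v = wedge u (s • u + t • v) := by
    funext i
    fin_cases i <;> simp [wedge] <;> ring
  rw [hst] at h1 h2
  have h3 : wedge 0 v = 0 := by
    funext i
    fin_cases i <;> simp [wedge]
  have h4 : wedge u 0 = 0 := by
    funext i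
    fin_cases i <;> simp [wedge]
  rw [h3] at h1
  rw [h4] at h2
  exact ⟨(smul_eq_zero.mp h1).resolve_right h, (smul_eq_zero.mp h2).resolve_right h⟩

theorem pairing_eq_zero_iff {x : Fin 6 → ℂ} {p : Fin 4 → ℂ} : pairing x p = 0 ↔
    p 1 * x 5 - p 2 * x 4 + p 3 * x 3 = 0 ∧ p 3 * x 1 - p 2 * x 2 + p 0 * x 5 = 0 ∧
    -p 3 * x 0 + p 1 * x 2 - p 0 * x 4 = 0 ∧ p 2 * x 0 - p 1 * x 1 + p 0 * x 3 = 0 := by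
  refine ⟨pairing_eq_zero, fun ⟨h0, h1, h2, h3⟩ => LinearMap.ext fun v => ?_⟩
  simp only [pairing_apply, dualForm, wedge, dotProduct, Fin.sum_univ_succ, LinearMap.zero_apply]
  simp
  linear_combination -v 0 * h0 + v 1 * h1 + v 2 * h2 + v 3 * h3

theorem dualForm_dotProduct (x y : Fin 6 → ℂ) : dualForm x ⬝ᵥ y = x ⬝ᵥ dualForm y := by
  simp [dualForm, dotProduct, Fin.sum_univ_succ]
  ring

theorem pairing_dualForm_wedge {a b p : Fin 4 → ℂ} (ha : a ⬝ᵥ p = 0) (hb : b ⬝ᵥ p = 0) :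
    pairing (dualForm (wedge a b)) p = 0 := by
  rw [pairing_eq_zero_iff]
  simp [dotProduct, Fin.sum_univ_succ] at ha hb
  simp only [dualForm, wedge]
  simp
  refine ⟨?_, ?_, ?_, ?_⟩ <;> grind

theorem dotProduct_eq_zero_of_pairing_wedge {a b k w : Fin 4 → ℂ} (hab : wedge a b ≠ 0)
    (hk : pairing (wedge a b) k = 0) (ha : a ⬝ᵥ w = 0) (hb : b ⬝ᵥ w = 0) : k ⬝ᵥ w = 0 := by
  rw [pairing_eq_zero_iff] at hk
  by_contra h
  apply hab
  simp [dotProduct, Fin.sum_univ_succ, wedge] at ha hb h hk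
  obtain ⟨h0, h1, h2, h3⟩ := hk
  funext i
  refine (mul_eq_zero_iff_left h).mp ?_
  fin_cases i <;> simp [wedge] <;> grind

theorem finrank_eq_two {a b : Fin 4 → ℂ} (hab : wedge a b ≠ 0) {T : Submodule ℂ (Fin 4 → ℂ)}
    (hT : ∀ w, w ∈ T ↔ a ⬝ᵥ w = 0 ∧ b ⬝ᵥ w = 0) : Module.finrank ℂ T = 2 := by
  have h1 : (Matrix.of ![a, b]).rank = 2 := by
    simpa using (linearIndependent_of_wedge_ne_zero hab).rank_matrix (M := Matrix.of ![a, b])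
  have h2 : T = LinearMap.ker (Matrix.of ![a, b]).mulVecLin := by
    ext w
    rw [hT, LinearMap.mem_ker, Matrix.mulVecLin_apply, funext_iff, Fin.forall_fin_two]
    rfl
  have h3 := LinearMap.finrank_range_add_finrank_ker (Matrix.of ![a, b]).mulVecLin
  rw [← Matrix.rank, h1, ← h2] at h3
  simp at h3
  omega

/-- Both basis vectors of the line are killed by wedging with the dual vector of the equations, so
that vector is proportional to their wedge. -/
theorem plucker_eq_dualForm {a b : Fin 4 → ℂ} (hab : dualForm (wedge a b) ≠ 0) (T : Line)
    (hT : ∀ w ∈ T.1, a ⬝ᵥ w = 0 ∧ b ⬝ᵥ w = 0) :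
    plucker T = Projectivization.mk ℂ (dualForm (wedge a b)) hab := by
  obtain ⟨i, hi⟩ := Function.ne_iff.mp hab
  have hi' : dualForm (wedge a b) i ≠ 0 := hi
  have h0 := hT _ (lineBasis T 0).2
  have h1 := hT _ (lineBasis T 1).2
  have h2 := fun j => mul_wedge_eq (pairing_dualForm_wedge h0.1 h0.2)
    (pairing_dualForm_wedge h1.1 h1.2) i j
  rw [plucker, Projectivization.mk_eq_mk_iff']
  refine ⟨wedge (lineBasis T 0) (lineBasis T 1) i / dualForm (wedge a b) i, funext fun j => ?_⟩
  simp only [Pi.smul_apply, smul_eq_mul]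
  field_simp
  linear_combination -h2 j

/-- If all pairs in `N` were proportional, their annihilator would have dimension at least three.
The remaining equations lie in the span of `a` and `b` because these already cut out `T`. -/
theorem exists_wedge_ne_zero {N : Set (Fin 4 → ℂ)} {T : Submodule ℂ (Fin 4 → ℂ)}
    (hT : ∀ w, w ∈ T ↔ ∀ k ∈ N, k ⬝ᵥ w = 0) (h2 : Module.finrank ℂ T = 2) :
    ∃ a ∈ N, ∃ b ∈ N, wedge a b ≠ 0 ∧ ∀ k ∈ N, pairing (wedge a b) k = 0 := by
  have h3 : ∃ a ∈ N, ∃ b ∈ N, wedge a b ≠ 0 := by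
    by_contra! h
    obtain ⟨a, ha⟩ : ∃ a : Fin 4 → ℂ, ∀ k ∈ N, ∃ c : ℂ, k = c • a := by
      by_cases h0 : ∃ a ∈ N, a ≠ 0
      · obtain ⟨a, haN, ha⟩ := h0
        obtain ⟨i, hi⟩ := Function.ne_iff.mp ha
        have hi' : a i ≠ 0 := hi
        refine ⟨a, fun k hk => ⟨k i / a i, funext fun j => ?_⟩⟩
        have := minor_eq_zero (h a haN k hk) i j
        simp only [Pi.smul_apply, smul_eq_mul]
        field_simp
        linear_combination this
      · push Not at h0
        exact ⟨0, fun k hk => ⟨0, by simp [h0 k hk]⟩⟩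
    have h4 : LinearMap.ker (dotProductBilin ℂ ℂ a) ≤ T := by
      intro w hw
      have hw' : a ⬝ᵥ w = 0 := hw
      rw [hT]
      intro k hk
      obtain ⟨c, rfl⟩ := ha k hk
      rw [smul_dotProduct, hw', smul_zero]
    have h5 := Submodule.finrank_mono h4
    have h6 := LinearMap.finrank_range_add_finrank_ker (dotProductBilin ℂ ℂ a)
    have h7 := Submodule.finrank_le (LinearMap.range (dotProductBilin ℂ ℂ a))
    simp at h6 h7
    omega
  obtain ⟨a, ha, b, hb, hab⟩ := h3
  refine ⟨a, ha, b, hb, hab, fun k hk => ?_⟩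
  have h4 := plucker_eq_dualForm (dualForm_ne_zero hab) ⟨T, h2⟩ fun w hw =>
    ⟨(hT w).mp hw a ha, (hT w).mp hw b hb⟩
  rw [plucker, eq_comm, Projectivization.mk_eq_mk_iff'] at h4
  obtain ⟨c, hc⟩ := h4
  have h5 : wedge a b = c • dualForm
      (wedge (lineBasis ⟨T, h2⟩ 0 : Fin 4 → ℂ) (lineBasis ⟨T, h2⟩ 1 : Fin 4 → ℂ)) := by
    rw [← dualForm_smul, hc, dualForm_dualForm]
  have h6 := pairing_dualForm_wedge (p := k)
    (by rw [dotProduct_comm]; exact (hT _).mp (lineBasis ⟨T, h2⟩ 0).2 k hk)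
    (by rw [dotProduct_comm]; exact (hT _).mp (lineBasis ⟨T, h2⟩ 1).2 k hk)
  refine LinearMap.ext fun v => ?_
  have h7 := LinearMap.congr_fun h6 v
  rw [pairing_apply, LinearMap.zero_apply] at h7 ⊢
  rw [h5, dotProduct_smul, h7, smul_zero]

end Annihilators

/-! ### Tangent lines as images of gradient maps -/

section TangentLines

/-- The gradient of a polynomial at a vector. -/
noncomputable def grad (F : MvPolynomial (Fin 4) ℂ) (v : Fin 4 → ℂ) : Fin 4 → ℂ := fun j => eval v (pderiv j F)

/-- The dual Plücker coordinates of two gradients, as polynomials. -/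
noncomputable def conormal (F G : MvPolynomial (Fin 4) ℂ) : Fin 6 → MvPolynomial (Fin 4) ℂ :=
  ![pderiv 2 F * pderiv 3 G - pderiv 3 F * pderiv 2 G,
    pderiv 3 F * pderiv 1 G - pderiv 1 F * pderiv 3 G,
    pderiv 1 F * pderiv 2 G - pderiv 2 F * pderiv 1 G,
    pderiv 0 F * pderiv 3 G - pderiv 3 F * pderiv 0 G,
    pderiv 2 F * pderiv 0 G - pderiv 0 F * pderiv 2 G,
    pderiv 0 F * pderiv 1 G - pderiv 1 F * pderiv 0 G]

/-- The `3 × 3` minors of three gradients, as polynomials. -/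
noncomputable def coplanarity (F G H : MvPolynomial (Fin 4) ℂ) : Fin 4 → MvPolynomial (Fin 4) ℂ :=
  ![pderiv 1 H * conormal F G 0 + pderiv 2 H * conormal F G 1 + pderiv 3 H * conormal F G 2,
    pderiv 2 H * conormal F G 3 + pderiv 3 H * conormal F G 4 - pderiv 0 H * conormal F G 0,
    pderiv 3 H * conormal F G 5 - pderiv 1 H * conormal F G 3 - pderiv 0 H * conormal F G 1,
    pderiv 2 H * conormal F G 5 + pderiv 1 H * conormal F G 4 + pderiv 0 H * conormal F G 2]

theorem eval_conormal (F G : MvPolynomial (Fin 4) ℂ) (v : Fin 4 → ℂ) :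
    (fun i => eval v (conormal F G i)) = dualForm (wedge (grad F v) (grad G v)) := by
  funext i
  fin_cases i <;> simp [conormal, dualForm, wedge, grad]

theorem eval_coplanarity (F G H : MvPolynomial (Fin 4) ℂ) (v : Fin 4 → ℂ) :
    (∀ i, eval v (coplanarity F G H i) = 0) ↔
      pairing (wedge (grad F v) (grad G v)) (grad H v) = 0 := by
  rw [pairing_eq_zero_iff, Fin.forall_fin_succ, Fin.forall_fin_succ, Fin.forall_fin_succ,
    Fin.forall_fin_succ]
  simp [coplanarity, conormal, wedge, grad]
  grind

theorem isHomogeneous_conormal {F G : MvPolynomial (Fin 4) ℂ} {k l : ℕ} (hF : F.IsHomogeneous k)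
    (hG : G.IsHomogeneous l) (i : Fin 6) : (conormal F G i).IsHomogeneous (k - 1 + (l - 1)) := by
  have h : ∀ a b c d : Fin 4, (pderiv a F * pderiv b G - pderiv c F * pderiv d G).IsHomogeneous
      (k - 1 + (l - 1)) := fun a b c d => (hF.pderiv.mul hG.pderiv).sub (hF.pderiv.mul hG.pderiv)
  fin_cases i
  exacts [h 2 3 3 2, h 3 1 1 3, h 1 2 2 1, h 0 3 3 0, h 2 0 0 2, h 0 1 1 0]

theorem isHomogeneous_coplanarity {F G H : MvPolynomial (Fin 4) ℂ} {k l m : ℕ}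
    (hF : F.IsHomogeneous k) (hG : G.IsHomogeneous l) (hH : H.IsHomogeneous m) (i : Fin 4) :
    (coplanarity F G H i).IsHomogeneous (m - 1 + (k - 1 + (l - 1))) := by
  have h : ∀ a b, (pderiv a H * conormal F G b).IsHomogeneous (m - 1 + (k - 1 + (l - 1))) :=
    fun a b => hH.pderiv.mul (isHomogeneous_conormal hF hG b)
  fin_cases i
  exacts [((h 1 0).add (h 2 1)).add (h 3 2), ((h 2 3).add (h 3 4)).sub (h 0 0),
    ((h 3 5).sub (h 1 3)).sub (h 0 1), ((h 2 5).add (h 1 4)).add (h 0 2)]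

theorem grad_smul {F : MvPolynomial (Fin 4) ℂ} {k : ℕ} (hF : F.IsHomogeneous k) (c : ℂ)
    (v : Fin 4 → ℂ) : grad F (c • v) = c ^ (k - 1) • grad F v :=
  funext fun _ => eval_smul_of_isHomogeneous hF.pderiv c v

/-- The points of the dual image of a variety under the conormal map of `F` and `G`, at which the
gradients of all members of `𝓖` are combinations of the gradients of `F` and `G`. -/
def tangentPoints (𝓖 : Finset (MvPolynomial (Fin 4) ℂ)) (P : Ideal (MvPolynomial (Fin 4) ℂ))
    (F G : MvPolynomial (Fin 4) ℂ) : Set (Proj 6) :=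
  {q | ∃ v ∈ zeros P, v ≠ 0 ∧ (∀ H ∈ 𝓖, ∀ i, eval v (coplanarity F G H i) = 0) ∧
    ∃ h : (fun i => eval v (conormal F G i)) ≠ 0, q = Projectivization.mk ℂ _ h}

/-- If the coplanarity minors vanish on the component, the set is the full image of the conormal
map. Otherwise some minor restricts it to finitely many points of the component. -/
theorem tangentPoints_finite_or {𝓖 : Finset (MvPolynomial (Fin 4) ℂ)}
    (h𝓖 : ∀ F ∈ 𝓖, ∃ k, F.IsHomogeneous k) {P : Ideal (MvPolynomial (Fin 4) ℂ)} [P.IsPrime]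
    (hP : IsHomIdeal P) (hd : HasDimLETwo P) {F G : MvPolynomial (Fin 4) ℂ} (hF : F ∈ 𝓖)
    (hG : G ∈ 𝓖) : (tangentPoints 𝓖 P F G).Finite ∨
      ∃ J, IsCurveUpToFinite (tangentPoints 𝓖 P F G) J := by
  obtain ⟨k, hk⟩ := h𝓖 F hF
  obtain ⟨l, hl⟩ := h𝓖 G hG
  by_cases h : ∀ H ∈ 𝓖, ∀ i, coplanarity F G H i ∈ P
  · have h1 : tangentPoints 𝓖 P F G = imagePoints P (conormal F G) := by
      ext q
      constructor
      · rintro ⟨v, hv, hv0, -, hq⟩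
        exact ⟨v, hv, hv0, hq⟩
      · rintro ⟨v, hv, hv0, hq⟩
        exact ⟨v, hv, hv0, fun H hH i => hv _ (h H hH i), hq⟩
    rw [h1]
    exact imagePoints_finite_or hP hd (isHomogeneous_conormal hk hl)
  · left
    push Not at h
    obtain ⟨H, hH, i, hi⟩ := h
    obtain ⟨m, hm⟩ := h𝓖 H hH
    have hχ := isHomogeneous_coplanarity hk hl hm i
    refine ((finite_projZeros_inter hP hd hi).biUnion (t := fun p => {q | ∃ (v : Fin 4 → ℂ)
      (hv : v ≠ 0) (h : (fun i => eval v (conormal F G i)) ≠ 0),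
      p = Projectivization.mk ℂ v hv ∧ q = Projectivization.mk ℂ _ h}) fun p _ => ?_).subset ?_
    · refine Set.Subsingleton.finite ?_
      rintro _ ⟨v, hv, h, rfl, rfl⟩ _ ⟨w, hw, h', hvw, rfl⟩
      obtain ⟨c, rfl⟩ := (Projectivization.mk_eq_mk_iff' ..).mp hvw
      rw [Projectivization.mk_eq_mk_iff']
      exact ⟨c ^ (k - 1 + (l - 1)), funext fun i =>
        (eval_smul_of_isHomogeneous (isHomogeneous_conormal hk hl i) c w).symm⟩
    · rintro q ⟨v, hv, hv0, hcop, h, rfl⟩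
      simp only [Set.mem_iUnion]
      refine ⟨Projectivization.mk ℂ v hv0, ⟨(rep_mk_mem_zeros hP hv0).mpr hv, fun c => ?_⟩,
        v, hv0, h, rfl, rfl⟩
      obtain ⟨a, ha⟩ := Projectivization.exists_smul_eq_mk_rep ℂ v hv0
      rw [← ha, Units.smul_def, smul_smul, eval_smul_of_isHomogeneous hχ, hcop H hH i, mul_zero]

theorem exists_homogeneous_generators {n : ℕ} {I : Ideal (MvPolynomial (Fin n) ℂ)}
    (hI : IsHomIdeal I) : ∃ 𝓖 : Finset (MvPolynomial (Fin n) ℂ),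
      (∀ F ∈ 𝓖, ∃ k, F.IsHomogeneous k) ∧ Ideal.span (𝓖 : Set _) = I := by
  classical
  obtain ⟨S, hS⟩ := IsNoetherian.noetherian I
  refine ⟨S.biUnion fun F =>
    (Finset.range (F.totalDegree + 1)).image fun k => homogeneousComponent k F, ?_, ?_⟩
  · intro F hF
    simp only [Finset.mem_biUnion, Finset.mem_image] at hF
    obtain ⟨F, -, k, -, rfl⟩ := hF
    exact ⟨k, homogeneousComponent_isHomogeneous k F⟩
  · apply le_antisymm
    · rw [Ideal.span_le]
      intro F hF
      simp only [Finset.coe_biUnion, Set.mem_iUnion, Finset.mem_coe, Finset.mem_image] at hF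
      obtain ⟨F, hF, k, -, rfl⟩ := hF
      exact hI F (hS ▸ Submodule.subset_span hF) k
    · rw [← hS, Submodule.span_le]
      intro F hF
      rw [← sum_homogeneousComponent F]
      refine Ideal.sum_mem _ fun k hk => Ideal.subset_span ?_
      simp only [Finset.coe_biUnion, Set.mem_iUnion, Finset.mem_coe, Finset.mem_image]
      exact ⟨F, hF, k, hk, rfl⟩

variable {C : Set (Proj 4)} {𝓖 : Finset (MvPolynomial (Fin 4) ℂ)}

theorem mem_tangentSpace_iff (h𝓖 : Ideal.span (𝓖 : Set _) = projIdeal C) {v : Fin 4 → ℂ}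
    (hv : v ∈ cone C) (w : Fin 4 → ℂ) :
    w ∈ tangentSpace C v ↔ ∀ k ∈ (fun F => grad F v) '' (𝓖 : Set _), k ⬝ᵥ w = 0 := by
  constructor
  · rintro hw _ ⟨F, hF, rfl⟩
    exact hw F (h𝓖 ▸ Ideal.subset_span hF)
  · intro hw F hF
    change grad F v ⬝ᵥ w = 0
    rw [← h𝓖] at hF
    induction hF using Submodule.span_induction with
    | mem F hF => exact hw _ ⟨F, hF, rfl⟩
    | zero => simp [grad, dotProduct]
    | add F G _ _ hF hG =>
      have : grad (F + G) v = grad F v + grad G v := funext fun j => by simp [grad]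
      rw [this, add_dotProduct, hF, hG, add_zero]
    | smul A F hF hFw =>
      have hF0 : eval v F = 0 := by
        have : F ∈ projIdeal C := h𝓖 ▸ hF
        exact mem_projIdeal.mp this v hv
      -- By the product rule, the term with the gradient of `A` drops out because `F` vanishes at
      -- `v`.
      have : grad (A • F) v = eval v A • grad F v := funext fun j => by
        simp [grad, hF0]
      rw [this, smul_dotProduct, hFw, smul_zero]

theorem tangentSpace_smul (h𝓖 : ∀ F ∈ 𝓖, ∃ k, F.IsHomogeneous k)
    (hspan : Ideal.span (𝓖 : Set _) = projIdeal C) {v : Fin 4 → ℂ}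
    (hv : v ∈ cone C) {c : ℂ} (hc : c ≠ 0) : tangentSpace C (c • v) = tangentSpace C v := by
  ext w
  rw [mem_tangentSpace_iff hspan hv, mem_tangentSpace_iff hspan (smul_mem_cone hv hc),
    Set.forall_mem_image, Set.forall_mem_image]
  refine forall₂_congr fun F hF => ?_
  obtain ⟨k, hk⟩ := h𝓖 F hF
  rw [grad_smul hk, smul_dotProduct, smul_eq_zero, or_iff_right (pow_ne_zero _ hc)]

/-- A point is nonsingular exactly when two gradients of generators are independent there and span
all the others. Splitting by the component through the point and by this pair gives finitely many
pieces. -/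
theorem image_plucker_tangentLines (hC : IsZariskiClosed C)
    (h𝓖 : ∀ F ∈ 𝓖, ∃ k, F.IsHomogeneous k) (hspan : Ideal.span (𝓖 : Set _) = projIdeal C)
    {s : Finset (Ideal (MvPolynomial (Fin 4) ℂ))} (hs : ∀ P, P ∈ s ↔ P ∈ (projIdeal C).minimalPrimes) :
    plucker '' tangentLines C =
      ⋃ t ∈ s ×ˢ 𝓖 ×ˢ 𝓖, tangentPoints 𝓖 t.1 t.2.1 t.2.2 := by
  ext q
  simp only [Set.mem_iUnion, Finset.mem_product, exists_prop, Prod.exists, hs]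
  constructor
  · rintro ⟨T, ⟨m, hm, hT⟩, rfl⟩
    have hmc : m.rep ∈ cone C := by simpa [cone, m.rep_nonzero] using hm
    obtain ⟨P, hP, hmP⟩ := (mem_iff_exists_minimalPrimes hC).mp hm
    have hTm := mem_tangentSpace_iff hspan hmc
    rw [← hT] at hTm
    obtain ⟨_, ⟨F, hF, rfl⟩, _, ⟨G, hG, rfl⟩, hFG, hH⟩ := exists_wedge_ne_zero hTm T.2
    refine ⟨P, F, G, ⟨hP, hF, hG⟩, m.rep, hmP, m.rep_nonzero, fun H hH' =>
      (eval_coplanarity F G H _).mpr (hH _ ⟨H, hH', rfl⟩), ?_⟩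
    refine ⟨by rw [eval_conormal]; exact dualForm_ne_zero hFG, ?_⟩
    simp only [eval_conormal]
    exact plucker_eq_dualForm _ T fun w hw =>
      ⟨(hTm w).mp hw _ ⟨F, hF, rfl⟩, (hTm w).mp hw _ ⟨G, hG, rfl⟩⟩
  · rintro ⟨P, F, G, ⟨hP, hF, hG⟩, v, hv, hv0, hH, h, rfl⟩
    have hvc : v ∈ cone C := (mem_cone_iff_of_isZariskiClosed hC hv0).mpr
      (mem_zeros_iff_exists_minimalPrimes.mpr ⟨P, hP, hv⟩)
    have hFG : wedge (grad F v) (grad G v) ≠ 0 := by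
      intro h0
      apply h
      rw [eval_conormal, h0]
      funext i
      fin_cases i <;> simp [dualForm]
    have hTv := mem_tangentSpace_iff hspan hvc
    have hT : ∀ w, w ∈ tangentSpace C v ↔ grad F v ⬝ᵥ w = 0 ∧ grad G v ⬝ᵥ w = 0 := by
      intro w
      rw [hTv]
      refine ⟨fun hw => ⟨hw _ ⟨F, hF, rfl⟩, hw _ ⟨G, hG, rfl⟩⟩, ?_⟩
      rintro ⟨h1, h2⟩ _ ⟨H, hH', rfl⟩
      exact dotProduct_eq_zero_of_pairing_wedge hFG ((eval_coplanarity F G H v).mp (hH H hH')) h1 h2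
    refine ⟨⟨tangentSpace C v, finrank_eq_two hFG hT⟩, ⟨Projectivization.mk ℂ v hv0, hvc.2, ?_⟩, ?_⟩
    · obtain ⟨a, ha⟩ := Projectivization.exists_smul_eq_mk_rep ℂ v hv0
      rw [← ha, Units.smul_def, tangentSpace_smul h𝓖 hspan hvc a.ne_zero]
    · simp only [eval_conormal]
      exact plucker_eq_dualForm _ _ fun w hw => (hT w).mp hw

theorem exists_hasGenericDegree_tangentLines (hC : IsAlgebraicCurve C) :
    (∃ d, HasGenericDegree (plucker '' tangentLines C) d) ∧
      (zariskiClosure (plucker '' tangentLines C) \ plucker '' tangentLines C).Finite := by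
  obtain ⟨𝓖, h𝓖, hspan⟩ := exists_homogeneous_generators (isHomIdeal_projIdeal C)
  have hfin := Ideal.finite_minimalPrimes_of_isNoetherianRing _ (projIdeal C)
  rw [image_plucker_tangentLines hC.isClosed h𝓖 hspan (s := hfin.toFinset) fun P => by simp]
  have key : ∀ t ∈ hfin.toFinset ×ˢ 𝓖 ×ˢ 𝓖, (tangentPoints 𝓖 t.1 t.2.1 t.2.2).Finite ∨
      ∃ J, IsCurveUpToFinite (tangentPoints 𝓖 t.1 t.2.1 t.2.2) J := by
    rintro ⟨P, F, G⟩ ht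
    simp only [Finset.mem_product, Set.Finite.mem_toFinset] at ht
    obtain ⟨hP, hF, hG⟩ := ht
    have hprime : P.IsPrime := hP.1.1
    exact tangentPoints_finite_or h𝓖 ((isHomIdeal_projIdeal C).of_mem_minimalPrimes hP)
      (hasDimLETwo_of_ringKrullDim_eq (hC.dim_eq P hP)) hF hG
  exact ⟨exists_hasGenericDegree_biUnion _ key, finite_zariskiClosure_diff _ key⟩

end TangentLines

/-! ### Incidence of lines in Plücker coordinates -/

section LineIncidence

theorem smul_eq_of_pairing_wedge {a b w : Fin 4 → ℂ} (h : pairing (wedge a b) w = 0)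
    (i j : Fin 4) : (a i * b j - a j * b i) • w
      = (w i * b j - w j * b i) • a + (a i * w j - a j * w i) • b := by
  rw [pairing_eq_zero_iff] at h
  simp [wedge] at h
  obtain ⟨h0, h1, h2, h3⟩ := h
  funext k
  simp only [Pi.smul_apply, Pi.add_apply, smul_eq_mul]
  fin_cases i <;> fin_cases j <;> fin_cases k <;> simp <;> grind

theorem mem_line_iff (T : Line) (w : Fin 4 → ℂ) :
    w ∈ T.1 ↔ pairing (wedge (lineBasis T 0) (lineBasis T 1)) w = 0 := by
  constructor
  · intro hw
    have h := (lineBasis T).sum_repr ⟨w, hw⟩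
    rw [Fin.sum_univ_two] at h
    have h1 := congrArg Subtype.val h
    change _ • (lineBasis T 0 : Fin 4 → ℂ) + _ • (lineBasis T 1 : Fin 4 → ℂ) = w at h1
    rw [← h1, pairing_eq_zero_iff]
    simp [wedge]
    refine ⟨?_, ?_, ?_, ?_⟩ <;> ring
  · intro hw
    obtain ⟨i, j, hij⟩ : ∃ i j : Fin 4, (lineBasis T 0 : Fin 4 → ℂ) i * (lineBasis T 1 : Fin 4 → ℂ) j
        - (lineBasis T 0 : Fin 4 → ℂ) j * (lineBasis T 1 : Fin 4 → ℂ) i ≠ 0 := by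
      by_contra! h
      apply wedge_ne_zero (linearIndependent_lineBasis T)
      funext k
      fin_cases k
      exacts [h 0 1, h 0 2, h 0 3, h 1 2, h 1 3, h 2 3]
    rw [← T.1.smul_mem_iff hij, smul_eq_of_pairing_wedge hw]
    exact T.1.add_mem (T.1.smul_mem _ (lineBasis T 0).2) (T.1.smul_mem _ (lineBasis T 1).2)

/-- A line is recovered from its Plücker vector as the set of vectors whose wedge with it vanishes.
-/
theorem plucker_injective : Function.Injective plucker := by
  intro S T h
  rw [plucker, plucker, Projectivization.mk_eq_mk_iff'] at h
  obtain ⟨c, hc⟩ := h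
  refine Subtype.ext (Submodule.eq_of_le_of_finrank_eq (fun w hw => ?_) (T.2.trans S.2.symm)).symm
  rw [mem_line_iff] at hw ⊢
  refine LinearMap.ext fun v => ?_
  rw [pairing_apply, ← hc, dotProduct_smul, ← pairing_apply, hw]
  simp

theorem dotProduct_dualForm_wedge_eq_det (a b c d : Fin 4 → ℂ) :
    dualForm (wedge c d) ⬝ᵥ wedge a b = (Matrix.of ![a, b, c, d]).det := by
  simp [Matrix.det_succ_row_zero, Fin.sum_univ_succ, dualForm, wedge, dotProduct, Fin.succAbove]
  ring

/-- Two lines meet when their four basis vectors are dependent, and the pairing is the Laplace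
expansion of the determinant. -/
theorem meets_iff (T L : Line) : Meets T L ↔ dualForm (wedge (lineBasis L 0) (lineBasis L 1)) ⬝ᵥ
    wedge (lineBasis T 0) (lineBasis T 1) = 0 := by
  rw [dotProduct_dualForm_wedge_eq_det, ← Matrix.exists_vecMul_eq_zero_iff]
  have hvec : ∀ (v : Fin 4 → ℂ) (a b c d : Fin 4 → ℂ), Matrix.vecMul v (Matrix.of ![a, b, c, d])
      = v 0 • a + v 1 • b + (v 2 • c + v 3 • d) := by
    intro v a b c d
    funext j
    simp [Matrix.vecMul, dotProduct, Fin.sum_univ_succ]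
    ring
  simp only [hvec]
  constructor
  · rintro ⟨p, hT, hL⟩
    have hp : p.rep ∈ p.submodule := by
      rw [Projectivization.submodule_eq]
      exact Submodule.mem_span_singleton_self _
    have key : ∀ M : Line, p.rep ∈ M.1 → ∃ s t : ℂ,
        p.rep = s • (lineBasis M 0 : Fin 4 → ℂ) + t • (lineBasis M 1 : Fin 4 → ℂ) := by
      intro M hM
      have h := (lineBasis M).sum_repr ⟨p.rep, hM⟩
      rw [Fin.sum_univ_two] at h
      exact ⟨_, _, (congrArg Subtype.val h).symm⟩
    obtain ⟨s, t, h1⟩ := key T (hT hp)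
    obtain ⟨s', t', h2⟩ := key L (hL hp)
    refine ⟨![s, t, -s', -t'], fun h0 => p.rep_nonzero ?_, ?_⟩
    · have h3 : s = 0 := congrFun h0 0
      have h4 : t = 0 := congrFun h0 1
      rw [h1, h3, h4, zero_smul, zero_smul, add_zero]
    · change s • _ + t • _ + (-s' • _ + -t' • _) = _
      rw [← h1, h2, neg_smul, neg_smul, ← neg_add, add_neg_cancel]
  · rintro ⟨v, hv, h⟩
    set z := v 0 • (lineBasis T 0 : Fin 4 → ℂ) + v 1 • (lineBasis T 1 : Fin 4 → ℂ) with hz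
    have hzT : z ∈ T.1 :=
      T.1.add_mem (T.1.smul_mem _ (lineBasis T 0).2) (T.1.smul_mem _ (lineBasis T 1).2)
    have hzL : z ∈ L.1 := by
      rw [eq_neg_of_add_eq_zero_left h]
      exact L.1.neg_mem
        (L.1.add_mem (L.1.smul_mem _ (lineBasis L 0).2) (L.1.smul_mem _ (lineBasis L 1).2))
    have hz0 : z ≠ 0 := by
      intro h0
      rw [h0, zero_add] at h
      have h1 := LinearIndependent.pair_iff.mp (linearIndependent_lineBasis T) _ _ h0
      have h2 := LinearIndependent.pair_iff.mp (linearIndependent_lineBasis L) _ _ h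
      apply hv
      funext i
      fin_cases i
      exacts [h1.1, h1.2, h2.1, h2.2]
    refine ⟨Projectivization.mk ℂ z hz0, ?_, ?_⟩ <;>
    · rw [Projectivization.submodule_mk, Submodule.span_singleton_le_iff_mem]
      assumption

end LineIncidence

/-! ### Rank and degree from the generic count -/

section GenericCounts

/-- The points of projective space at which all homogeneous components of a polynomial vanish. -/
def projLocus {n : ℕ} (Δ : MvPolynomial (Fin n) ℂ) : Set (Proj n) :=
  {p | ∀ k, eval p.rep (homogeneousComponent k Δ) = 0}

variable {n : ℕ} {Δ : MvPolynomial (Fin n) ℂ}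

theorem isZariskiClosed_projLocus (Δ : MvPolynomial (Fin n) ℂ) : IsZariskiClosed (projLocus Δ) := by
  refine ⟨Set.range fun k => homogeneousComponent k Δ, ?_, ?_⟩
  · rintro _ ⟨k, rfl⟩
    exact ⟨k, homogeneousComponent_isHomogeneous k Δ⟩
  · ext p
    simp [projLocus]

/-- `Δ` need not be homogeneous while a hyperplane fixes its coefficients only up to scale;
rescaling leaves the section unchanged, so one good representative is enough. -/
theorem exists_eval_smul_ne_zero {p : Proj n} (hp : p ∉ projLocus Δ) :
    ∃ c : ℂ, c ≠ 0 ∧ eval (c • p.rep) Δ ≠ 0 := by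
  by_contra! h
  exact hp fun k => eval_homogeneousComponent_eq_zero h k

theorem mk_notMem_projLocus {v : Fin n → ℂ} (hv : v ≠ 0) (h : eval v Δ ≠ 0) :
    Projectivization.mk ℂ v hv ∉ projLocus Δ := by
  intro hmem
  apply h
  obtain ⟨a, ha⟩ := Projectivization.exists_smul_eq_mk_rep ℂ v hv
  rw [← sum_homogeneousComponent Δ, map_sum]
  refine Finset.sum_eq_zero fun k _ => ?_
  have h1 := hmem k
  rw [← ha, Units.smul_def,
    eval_smul_of_isHomogeneous (homogeneousComponent_isHomogeneous k Δ)] at h1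
  exact (mul_eq_zero.mp h1).resolve_left (pow_ne_zero _ a.ne_zero)

theorem exists_wedge_ne_zero_and_eval_ne_zero {Δ : MvPolynomial (Fin 6) ℂ}
    (h : ∃ p u, eval (dualForm (wedge p u)) Δ ≠ 0) :
    ∃ p u, wedge p u ≠ 0 ∧ eval (dualForm (wedge p u)) Δ ≠ 0 := by
  have h1 : ∃ p u, eval (wedge p u) (X 0) ≠ 0 := ⟨![1, 0, 0, 0], ![0, 1, 0, 0], by simp [wedge]⟩
  obtain ⟨p, u, h2, h3⟩ := ((generically_wedge h1).and (generically_dualForm_wedge h)).exists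
  refine ⟨p, u, fun h0 => h2 ?_, h3⟩
  rw [h0]
  simp

theorem HasGenericDegree.hasDegree {S : Set (Proj 6)} {d : ℕ} (h : HasGenericDegree S d) :
    HasDegree S d := by
  obtain ⟨Δ, h1, h2⟩ := h
  obtain ⟨p, u, hpu, hΔ⟩ := exists_wedge_ne_zero_and_eval_ne_zero h1
  refine ⟨projLocus Δ, isZariskiClosed_projLocus Δ, fun h3 => ?_, fun a ha => ?_⟩
  · exact mk_notMem_projLocus (dualForm_ne_zero hpu) hΔ (h3 ▸ Set.mem_univ _)
  · obtain ⟨c, hc, hca⟩ := exists_eval_smul_ne_zero ha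
    rw [← h2 _ hca]
    congr 1
    ext x
    refine and_congr_right fun _ => ?_
    rw [smul_dotProduct, smul_eq_mul, mul_eq_zero, or_iff_right hc]
    change Projectivization.orthogonal a x ↔ _
    conv_lhs => rw [← a.mk_rep, ← x.mk_rep]
    exact Projectivization.orthogonal_mk a.rep_nonzero x.rep_nonzero

/-- The hyperplane dual to `L` cuts out the tangent lines meeting `L`. A decomposable vector at
which `Δ` is nonzero provides the line required for the open set to be nonempty. -/
theorem HasGenericDegree.hasRank {C : Set (Proj 4)} {d : ℕ}
    (h : HasGenericDegree (plucker '' tangentLines C) d) : HasRank C d := by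
  obtain ⟨Δ, h1, h2⟩ := h
  obtain ⟨p, u, hpu, hΔ⟩ := exists_wedge_ne_zero_and_eval_ne_zero h1
  obtain ⟨G, hG⟩ := exists_eval_dualForm Δ
  refine ⟨projLocus G, isZariskiClosed_projLocus G, ?_, fun L hL => ?_⟩
  · have hind := linearIndependent_of_wedge_ne_zero hpu
    have hfr : Module.finrank ℂ (Submodule.span ℂ (Set.range ![p, u])) = 2 := by
      simpa using finrank_span_eq_card hind
    refine ⟨⟨_, hfr⟩, ?_⟩
    have hp : p ∈ Submodule.span ℂ (Set.range ![p, u]) := Submodule.subset_span ⟨0, rfl⟩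
    have hu : u ∈ Submodule.span ℂ (Set.range ![p, u]) := Submodule.subset_span ⟨1, rfl⟩
    rw [plucker_eq _ hind hp hu]
    exact mk_notMem_projLocus _ (by rwa [hG])
  · obtain ⟨c, hc, hcL⟩ := exists_eval_smul_ne_zero hL
    rw [hG] at hcL
    rw [← h2 _ hcL, ← plucker_injective.encard_image]
    congr 1
    have key : ∀ T : Line, Meets T L ↔
        dualForm (c • (plucker L).rep) ⬝ᵥ (plucker T).rep = 0 := by
      intro T
      rw [meets_iff, plucker, plucker, dotProduct_rep_mk_eq_zero, dualForm_dotProduct (c • _),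
        dualForm_dotProduct, dotProduct_comm, dotProduct_comm (c • _),
        dotProduct_smul, smul_eq_mul, mul_eq_zero, or_iff_right hc, dotProduct_rep_mk_eq_zero]
    ext x
    constructor
    · rintro ⟨T, ⟨hT, hTL⟩, rfl⟩
      exact ⟨⟨T, hT, rfl⟩, (key T).mp hTL⟩
    · rintro ⟨⟨T, hT, rfl⟩, hx⟩
      exact ⟨T, ⟨hT, (key T).mpr hx⟩, rfl⟩

theorem HasGenericDegree.image_tangentCurve {C : Set (Proj 4)} {d : ℕ}
    (h : HasGenericDegree (plucker '' tangentLines C) d)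
    (hfin : (zariskiClosure (plucker '' tangentLines C) \ plucker '' tangentLines C).Finite) :
    HasGenericDegree (plucker '' tangentCurve C) d := by
  refine h.congr (hfin.subset ?_)
  rintro x (⟨⟨T, hT, rfl⟩, hx⟩ | ⟨⟨T, hT, rfl⟩, hx⟩)
  · exact absurd ⟨T, fun Z hZ => hZ.2 ⟨T, hT, rfl⟩, rfl⟩ hx
  · exact ⟨hT, hx⟩

end GenericCounts

end SpaceCurve

theorem mainTheorem8 (C : Set (SpaceCurve.Proj 4)) (hC : SpaceCurve.IsAlgebraicCurve C) :
    ∃ d : ℕ, SpaceCurve.HasRank C d ∧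
      SpaceCurve.HasDegree (SpaceCurve.plucker '' SpaceCurve.tangentCurve C) d := by
  obtain ⟨⟨d, hd⟩, hfin⟩ := SpaceCurve.exists_hasGenericDegree_tangentLines hC
  exact ⟨d, hd.hasRank, (hd.image_tangentCurve hfin).hasDegree⟩
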